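/- Conventions. A standard Borel space is a measurable space whose $\sigma$-algebra is the Borel $\sigma$-algebra of some Polish topology. An equivalence relation $E$ on a standard Borel space $X$ is *countable* if every $E$-class is countable, and *smooth* if there are a standard Borel space $Z$ and a Borel map $f:X\to Z$ with $x\mathrel{E}y\Leftrightarrow f(x)=f(y)$ for all $x,y\in X$. Let $\mathcal C^+=\{1,2,3,\dots\}\cup\{\aleph_0,2^{\aleph_0}\}$. An equivalence relation $D$ on a standard Borel space $W$ is *Borel parametrized* if there are standard Borel spaces $Z_{\mathfrak m}$ (possibly empty) and $Y_{\mathfrak m}$ with $|Y_{\mathfrak m}|=\mathfrak m$, for $\mathfrak m\in\mathcal C^+$, and a Borel bijection $\varphi:W\to\bigsqcup_{\mathfrak m\in\mathcal C^+}Z_{\mathfrak m}\times Y_{\mathfrak m}$ such that for all $x,y\in W$, $x\mathrel{D}y$ if and only if $\varphi(x)$ and $\varphi(y)$ have the same first coordinate in $\bigsqcup_{\mathfrak m}Z_{\mathfrak m}$. Let $E\subseteq F$ be smooth countable equivalence relations on a standard Borel space $X$, and give $X/F$ the quotient Borel structure (which is standard Borel). For an $F$-class $C$, its local fine shape is the sequence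 $\mathrm{lfs}(E,F)(C)=\langle n_m(C) : 1\le m\le\omega\rangle$, where $n_m(C)\in\{0,1,2,\dots\}\cup\{\omega\}$ is the number of $E$-classes contained in $C$ that have exactly $m$ elements. Let $S$ be the set of all sequences $\alpha=\langle\alpha(m):1\le m\le\omega\rangle$ with values in $\{0,1,2,\dots\}\cup\{\omega\}$ that are not constantly $0$. The global fine shape of $(E,F)$ is the function $\mathrm{gfs}(E,F)$ on $S$ that sends $\alpha$ to the cardinality of $\{C\in X/F : \mathrm{lfs}(E,F)(C)=\alpha\}$. Let $[\![\mathrm{lfs}(E,F)]\!]$ be the equivalence relation on $X/F$ that relates $C$ and $C'$ if and only if $\mathrm{lfs}(E,F)(C)=\mathrm{lfs}(E,F)(C')$. For pairs $(E,F)$ on $X$ and $(E',F')$ on $Y$, write $(E,F)\cong_B(E',F')$ if there is a Borel isomorphism $\psi:X\to Y$ such that for all $x,y\in X$, $x\mathrel{E}y\Leftrightarrow\psi(x)\mathrel{E'}\psi(y)$ and $x\mathrel{F}y\Leftrightarrow\psi(x)\mathrel{F'}\psi(y)$. Theorem. Let $E\subseteq F$ be smooth countable equivalence relations on a standard Borel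 space $X$. If $[\![\mathrm{lfs}(E,F)]\!]$ is not Borel parametrized, then there exist a standard Borel space $Y$ and smooth countable equivalence relations $E'\subseteq F'$ on $Y$ such that $\mathrm{gfs}(E,F)=\mathrm{gfs}(E',F')$ but $(E,F)\not\cong_B(E',F')$. -/

import Mathlib

universe u

open Cardinal

namespace SmoothPairs

/-- `E` is a countable equivalence relation: every `E`-class is countable. -/
def IsCountable {X : Type u} (E : Setoid X) : Prop :=
  ∀ x : X, {y : X | E x y}.Countable

/-- `E` is smooth: it is Borel reducible to equality on some standard Borel space. -/
def IsSmooth {X : Type u} [MeasurableSpace X] (E : Setoid X) : Prop :=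
  ∃ (Z : Type u) (_ : MeasurableSpace Z) (_ : StandardBorelSpace Z) (f : X → Z),
    Measurable f ∧ ∀ x y : X, E x y ↔ f x = f y

/-- The set of cardinalities of nonempty Borel sets: `1, 2, 3, …, ℵ₀` and the continuum. -/
def CPlus : Set Cardinal.{u} := {m | m ≠ 0 ∧ (m ≤ ℵ₀ ∨ m = 𝔠)}

/-- `E` is Borel parametrized: there is a Borel bijection `φ` of the space onto a disjoint union
`⨆ₘ Zₘ × Yₘ`, with `Zₘ`, `Yₘ` standard Borel (`Zₘ` possibly empty) and `|Yₘ| = m`, such that two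
points are `E`-equivalent iff their images have the same first coordinate in `⨆ₘ Zₘ`. -/
def BorelParametrized {X : Type u} [MeasurableSpace X] (E : Setoid X) : Prop :=
  ∃ (Z Y : CPlus.{u} → Type u)
    (_ : ∀ m, MeasurableSpace (Z m)) (_ : ∀ m, StandardBorelSpace (Z m))
    (_ : ∀ m, MeasurableSpace (Y m)) (_ : ∀ m, StandardBorelSpace (Y m))
    (φ : X → Σ m : CPlus.{u}, Z m × Y m),
    (∀ m, #(Y m) = m) ∧ Measurable φ ∧ Function.Bijective φ ∧
      ∀ x y : X, E x y ↔
        (⟨(φ x).1, (φ x).2.1⟩ : Σ m : CPlus.{u}, Z m) = ⟨(φ y).1, (φ y).2.1⟩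

/-- The number (in `ℕ ∪ {ω}`) of `E`-classes with exactly `m` elements. It is applied only to
equivalence relations on countable sets. -/
noncomputable def numClasses {X : Type u} (E : Setoid X) (m : ℕ∞) : ℕ∞ :=
  {D : Set X | D ∈ E.classes ∧ D.encard = m}.encard

/-- The set of local fine shapes: the sequences `⟨α(m) : 1 ≤ m ≤ ω⟩` with values in `ℕ ∪ {ω}`
that are not constantly zero. -/
def LocalFineShape : Type := {α : {m : ℕ∞ // 1 ≤ m} → ℕ∞ // α ≠ 0}

/-- The restriction of `E` to the `F`-class `C`. -/
def restrictToClass {X : Type u} (E F : Setoid X) (C : Quotient F) :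
    Setoid {x : X // Quotient.mk F x = C} :=
  E.comap Subtype.val

theorem numClasses_restrictToClass_ne_zero {X : Type u} (E F : Setoid X) (C : Quotient F) :
    (fun m : {m : ℕ∞ // 1 ≤ m} => numClasses (restrictToClass E F C) m) ≠ 0 := by
  obtain ⟨x, hx⟩ := Quotient.exists_rep C
  intro h
  let D : Set {x : X // Quotient.mk F x = C} := {y | restrictToClass E F C y ⟨x, hx⟩}
  have hD : D.Nonempty := ⟨⟨x, hx⟩, (restrictToClass E F C).refl _⟩
  have h0 := congrFun h ⟨D.encard, Set.one_le_encard_iff_nonempty.2 hD⟩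
  have hne : {D' : Set {x : X // Quotient.mk F x = C} |
      D' ∈ (restrictToClass E F C).classes ∧ D'.encard = D.encard}.Nonempty :=
    ⟨D, Setoid.mem_classes _ _, rfl⟩
  exact hne.ne_empty (Set.encard_eq_zero.1 h0)

/-- The local fine shape function on `X / F`: it sends an `F`-class `C` to the sequence
`⟨number of classes of size m of E restricted to C : 1 ≤ m ≤ ω⟩`. -/
noncomputable def lfs {X : Type u} (E F : Setoid X) (C : Quotient F) : LocalFineShape :=
  ⟨fun m => numClasses (restrictToClass E F C) m, numClasses_restrictToClass_ne_zero E F C⟩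

/-- The relation on `X / F` induced by `lfs`: having the same local fine shape. -/
noncomputable def lfsRel {X : Type u} (E F : Setoid X) : Setoid (Quotient F) := Setoid.ker (lfs E F)

/-- The global fine shape: it sends `α` to the number of `F`-classes of local fine shape `α`. -/
noncomputable def gfs {X : Type u} (E F : Setoid X) (α : LocalFineShape) : Cardinal.{u} :=
  #{C : Quotient F // lfs E F C = α}

/-- Simultaneous Borel isomorphism of pairs of equivalence relations. -/
def SimBorelIso {X Y : Type u} [MeasurableSpace X] [MeasurableSpace Y]
    (E F : Setoid X) (E' F' : Setoid Y) : Prop :=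
  ∃ φ : X ≃ᵐ Y, (∀ x y : X, E x y ↔ E' (φ x) (φ y)) ∧ (∀ x y : X, F x y ↔ F' (φ x) (φ y))

end SmoothPairs

open Set Filter Topology MeasureTheory

namespace SmoothPairs

section CantorScheme

open CantorScheme PiNat

theorem exists_continuous_injective_of_scheme {W : Type*} [MetricSpace W] [CompleteSpace W]
    {B : List Bool → Set W} {ε : ℕ → ENNReal} (hε : Tendsto ε atTop (𝓝 0))
    (hanti : ∀ s b, B (b :: s) ⊆ B s) (hne : ∀ s, (B s).Nonempty)
    (hdisj : ∀ s, Disjoint (closure (B (false :: s))) (closure (B (true :: s))))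
    (hdiam : ∀ s b, Metric.ediam (B (b :: s)) ≤ ε s.length) :
    ∃ h : (ℕ → Bool) → W, Continuous h ∧ Function.Injective h ∧
      ∀ x n, h x ∈ closure (B (res x n)) := by
  let A : List Bool → Set W := fun s => closure (B s)
  have hA : ClosureAntitone A := Antitone.closureAntitone
    (fun s b => closure_mono (hanti s b)) fun s => isClosed_closure
  have hd : VanishingDiam A := by
    intro x
    rw [← tendsto_add_atTop_iff_nat 1]
    refine tendsto_of_tendsto_of_tendsto_of_le_of_le tendsto_const_nhds hε
      (fun _ => zero_le) fun n => ?_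
    simp only [A, Metric.ediam_closure, res_succ]
    simpa using hdiam (res x n) (x n)
  have hj : CantorScheme.Disjoint A := by
    intro s a b hab
    cases a <;> cases b
    · exact absurd rfl hab
    · exact hdisj s
    · exact (hdisj s).symm
    · exact absurd rfl hab
  have hdom := hA.map_of_vanishingDiam hd fun s => (hne s).closure
  have hmem : ∀ x, x ∈ (inducedMap A).1 := fun x => hdom ▸ mem_univ x
  refine ⟨fun x => (inducedMap A).2 ⟨x, hmem x⟩, ?_, ?_, fun x n => ?_⟩
  · exact hd.map_continuous.comp (by fun_prop)
  · exact fun x y hxy => congrArg Subtype.val (hj.map_injective hxy)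
  · exact map_mem (A := A) ⟨x, hmem x⟩ n

end CantorScheme

section SigmaInjective

variable {W S : Type*} [MeasurableSpace W]

/-- `A` is covered by countably many measurable sets on which `f` is injective. -/
def IsSigmaInj (f : W → S) (A : Set W) : Prop :=
  ∃ B : ℕ → Set W, (∀ n, MeasurableSet (B n)) ∧ (∀ n, InjOn f (B n)) ∧ A ⊆ ⋃ n, B n

theorem IsSigmaInj.mono {f : W → S} {A A' : Set W} (h : IsSigmaInj f A) (hA : A' ⊆ A) :
    IsSigmaInj f A' := by
  obtain ⟨B, h1, h2, h3⟩ := h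
  exact ⟨B, h1, h2, hA.trans h3⟩

theorem IsSigmaInj.of_injOn {f : W → S} {A : Set W} (hA : MeasurableSet A) (h : InjOn f A) :
    IsSigmaInj f A :=
  ⟨fun _ => A, fun _ => hA, fun _ => h, fun _ hx => mem_iUnion.2 ⟨0, hx⟩⟩

theorem IsSigmaInj.iUnion {f : W → S} {ι : Type*} [Countable ι] {A : ι → Set W}
    (h : ∀ i, IsSigmaInj f (A i)) : IsSigmaInj f (⋃ i, A i) := by
  choose B h1 h2 h3 using h
  rcases isEmpty_or_nonempty ι with hι | hι
  · simpa using IsSigmaInj.of_injOn (f := f) MeasurableSet.empty (injOn_empty f)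
  · obtain ⟨e, he⟩ := exists_surjective_nat (ι × ℕ)
    refine ⟨fun n => B (e n).1 (e n).2, fun n => h1 _ _, fun n => h2 _ _, ?_⟩
    intro x hx
    obtain ⟨i, hi⟩ := mem_iUnion.1 hx
    obtain ⟨k, hk⟩ := mem_iUnion.1 (h3 i hi)
    obtain ⟨n, hn⟩ := he (i, k)
    exact mem_iUnion.2 ⟨n, by simpa [hn] using hk⟩

theorem IsSigmaInj.union {f : W → S} {A A' : Set W} (h : IsSigmaInj f A) (h' : IsSigmaInj f A') :
    IsSigmaInj f (A ∪ A') := by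
  rw [union_eq_iUnion]
  exact IsSigmaInj.iUnion (by rintro (_ | _) <;> assumption)

variable [MeasurableSpace S]

/-- The sets `A s`, for `s` of length `n`, are small as a tuple: off a measurable cover of the
codomain, one of them is negligible. -/
def SmallLevel (f : W → S) (n : ℕ) (A : List Bool → Set W) : Prop :=
  ∃ C : List Bool → Set S, (∀ s, MeasurableSet (C s)) ∧ (∀ x, ∃ s, s.length = n ∧ x ∈ C s) ∧
    ∀ s, s.length = n → IsSigmaInj f (A s ∩ f ⁻¹' C s)

/-- Split every set `A s` into the two pieces given by `P (p s)`. -/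
def splitFamily {K : Type*} (P : K → Bool → Set W) (A : List Bool → Set W) (p : List Bool → K) :
    List Bool → Set W
  | [] => ∅
  | b :: s => A s ∩ P (p s) b

theorem exists_splitFamily_not_small {K : Type*} [Countable K] [Nonempty K] {f : W → S}
    (hf : Measurable f) {P : K → Bool → Set W} (hP : ∀ k b, MeasurableSet (P k b))
    (hsep : ∀ w w', w ≠ w' → ∃ k, w ∈ P k false ∧ w' ∈ P k true) {n : ℕ} {A : List Bool → Set W}
    (hA : ¬ SmallLevel f n A) : ∃ p, ¬ SmallLevel f (n + 1) (splitFamily P A p) := by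
  by_contra! h
  apply hA
  have : Finite {s : List Bool // s.length = n} := List.finite_length_eq Bool n
  let k₀ : K := Classical.arbitrary K
  let ext : ({s : List Bool // s.length = n} → K) → List Bool → K :=
    fun q s => if hs : s.length = n then q ⟨s, hs⟩ else k₀
  choose C hCm hCc hCs using fun q => h (ext q)
  let D : List Bool → Set S := fun i => {x | ∀ k : K, ∃ q, ext q i = k ∧ ∃ b, x ∈ C q (b :: i)}
  have hD : ∀ i, MeasurableSet (D i) := by
    intro i
    have : D i = ⋂ k : K, ⋃ q, ⋃ (_ : ext q i = k), ⋃ b, C q (b :: i) := by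
      ext x; simp [D]
    rw [this]
    exact MeasurableSet.iInter fun k => MeasurableSet.iUnion fun q => MeasurableSet.iUnion fun _ =>
      MeasurableSet.iUnion fun b => hCm _ _
  refine ⟨D, hD, fun x => ?_, fun i hi => ?_⟩
  · by_contra! hx
    simp only [D, mem_ofPred, not_forall, not_exists, not_and] at hx
    choose k hk using hx
    let q : {s : List Bool // s.length = n} → K := fun s => k s.1 s.2
    obtain ⟨s, hs, hxs⟩ := hCc q x
    rcases s with _ | ⟨b, i⟩
    · simp at hs
    have hi : i.length = n := by simpa using hs
    exact hk i hi q (by simp [ext, hi, q]) b hxs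
  · let R : Set W := f ⁻¹' D i ∩ ⋂ q, ⋂ b, (P (ext q i) b ∩ f ⁻¹' C q (b :: i))ᶜ
    have hR : IsSigmaInj f R := by
      refine IsSigmaInj.of_injOn ((hf (hD i)).inter <| MeasurableSet.iInter fun q =>
        MeasurableSet.iInter fun b => ((hP _ _).inter (hf (hCm _ _))).compl) ?_
      intro w hw w' hw' hww
      by_contra hne
      obtain ⟨k, hk, hk'⟩ := hsep w w' hne
      obtain ⟨q, hq, b, hb⟩ := hw.1 k
      have h1 := mem_iInter.1 (mem_iInter.1 hw.2 q) b
      have h2 := mem_iInter.1 (mem_iInter.1 hw'.2 q) b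
      cases b
      · exact h1 ⟨hq ▸ hk, hb⟩
      · exact h2 ⟨hq ▸ hk', by simpa [hww] using hb⟩
    refine ((IsSigmaInj.iUnion fun q => IsSigmaInj.iUnion fun b =>
      hCs q (b :: i) (by simp [hi])).union hR).mono ?_
    rintro w ⟨hwA, hwD⟩
    by_cases hw : w ∈ R
    · exact Or.inr hw
    · left
      simp only [R, mem_inter_iff, hwD, true_and, mem_iInter, not_forall, mem_compl_iff,
        not_not] at hw
      obtain ⟨q, b, hqb⟩ := hw
      exact mem_iUnion.2 ⟨q, mem_iUnion.2 ⟨b, ⟨hwA, hqb.1⟩, hqb.2⟩⟩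

theorem SmallLevel.congr {f : W → S} {n : ℕ} {A A' : List Bool → Set W} (h : SmallLevel f n A)
    (hA : ∀ s, s.length = n → A s = A' s) : SmallLevel f n A' := by
  obtain ⟨C, h1, h2, h3⟩ := h
  exact ⟨C, h1, h2, fun s hs => hA s hs ▸ h3 s hs⟩

/-- A scheme of sets obtained by successive splitting. -/
def splitScheme {K : Type*} (P : ℕ → K → Bool → Set W) (p : ℕ → List Bool → K) :
    List Bool → Set W
  | [] => univ
  | b :: s => splitScheme P p s ∩ P s.length (p s.length s) b

theorem exists_splitScheme_not_small {K : Type*} [Countable K] [Nonempty K] {f : W → S}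
    (hf : Measurable f) {P : ℕ → K → Bool → Set W} (hP : ∀ n k b, MeasurableSet (P n k b))
    (hsep : ∀ n w w', w ≠ w' → ∃ k, w ∈ P n k false ∧ w' ∈ P n k true)
    (huniv : ¬ IsSigmaInj f univ) : ∃ p, ∀ n, ¬ SmallLevel f n (splitScheme P p) := by
  have h0 : ¬ SmallLevel f 0 (fun _ => (univ : Set W)) := by
    rintro ⟨C, -, h2, h3⟩
    refine huniv ((h3 [] rfl).mono fun w _ => ⟨mem_univ _, ?_⟩)
    obtain ⟨s, hs, hw⟩ := h2 (f w)
    obtain rfl := List.length_eq_zero_iff.1 hs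
    exact hw
  let step : ∀ n, {A : List Bool → Set W // ¬ SmallLevel f n A} → List Bool → K :=
    fun n A => (exists_splitFamily_not_small hf (hP n) (hsep n) A.2).choose
  let A : ∀ n, {A : List Bool → Set W // ¬ SmallLevel f n A} := fun n =>
    Nat.rec ⟨_, h0⟩ (fun n A => ⟨splitFamily (P n) A (step n A),
      (exists_splitFamily_not_small hf (hP n) (hsep n) A.2).choose_spec⟩) n
  refine ⟨fun n => step n (A n), fun n hn => (A n).2 (hn.congr ?_)⟩
  clear hn
  induction n with
  | zero =>
    intro s hs
    obtain rfl := List.length_eq_zero_iff.1 hs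
    rfl
  | succ n ih =>
    intro s hs
    rcases s with _ | ⟨b, s⟩
    · simp at hs
    have hs' : s.length = n := by simpa using hs
    subst hs'
    change splitScheme P _ s ∩ _ = (A s.length).1 s ∩ _
    rw [ih s rfl]

end SigmaInjective

section Basis

open TopologicalSpace

variable {W : Type*} [MetricSpace W] [SecondCountableTopology W]

open scoped Classical in
/-- Pairs of basic open sets with disjoint closures and diameters at most `2⁻ⁿ`, padded with empty
sets. -/
noncomputable def basicPair (n : ℕ) (k : countableBasis W × countableBasis W) (b : Bool) : Set W :=
  if Disjoint (closure (k.1 : Set W)) (closure (k.2 : Set W)) ∧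
    Metric.ediam (k.1 : Set W) ≤ 2⁻¹ ^ n ∧ Metric.ediam (k.2 : Set W) ≤ 2⁻¹ ^ n
  then cond b k.2 k.1 else ∅

theorem isOpen_basicPair (n : ℕ) (k : countableBasis W × countableBasis W) (b : Bool) :
    IsOpen (basicPair n k b) := by
  unfold basicPair
  split_ifs
  · cases b
    · exact isOpen_of_mem_countableBasis k.1.2
    · exact isOpen_of_mem_countableBasis k.2.2
  · exact isOpen_empty

theorem ediam_basicPair (n : ℕ) (k : countableBasis W × countableBasis W) (b : Bool) :
    Metric.ediam (basicPair n k b) ≤ 2⁻¹ ^ n := by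
  unfold basicPair
  split_ifs with h
  · cases b
    · exact h.2.1
    · exact h.2.2
  · simp

theorem disjoint_closure_basicPair (n : ℕ) (k : countableBasis W × countableBasis W) :
    Disjoint (closure (basicPair n k false)) (closure (basicPair n k true)) := by
  unfold basicPair
  split_ifs with h
  · exact h.1
  · simp

theorem exists_mem_countableBasis_ediam_le {w : W} {O : Set W} (hO : IsOpen O) (hw : w ∈ O)
    (n : ℕ) : ∃ U ∈ countableBasis W, w ∈ U ∧ U ⊆ O ∧ Metric.ediam U ≤ 2⁻¹ ^ n := by
  have hpos : (0 : ENNReal) < 2⁻¹ ^ n / 2 := by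
    apply ENNReal.div_pos
    · exact pow_ne_zero _ (by simp)
    · simp
  obtain ⟨U, hU, hwU, hUO⟩ := (isBasis_countableBasis W).exists_subset_of_mem_open
    (show w ∈ O ∩ Metric.eball w (2⁻¹ ^ n / 2) from ⟨hw, Metric.mem_eball_self hpos⟩)
    (hO.inter Metric.isOpen_eball)
  refine ⟨U, hU, hwU, hUO.trans inter_subset_left, ?_⟩
  refine (Metric.ediam_mono (hUO.trans inter_subset_right)).trans (Metric.ediam_eball_le.trans ?_)
  rw [ENNReal.mul_div_cancel (by simp) (by simp)]

theorem exists_basicPair {w w' : W} {O O' : Set W} (hO : IsOpen O) (hO' : IsOpen O')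
    (hw : w ∈ O) (hw' : w' ∈ O') (hne : w ≠ w') (n : ℕ) :
    ∃ k, w ∈ basicPair n k false ∧ w' ∈ basicPair n k true ∧
      basicPair n k false ⊆ O ∧ basicPair n k true ⊆ O' := by
  obtain ⟨G, hG, hGo, G', hG', hGo', hGG⟩ := exists_open_nhds_disjoint_closure hne
  obtain ⟨U, hU, hwU, hUO, hdU⟩ := exists_mem_countableBasis_ediam_le (hO.inter hGo) ⟨hw, hG⟩ n
  obtain ⟨V, hV, hwV, hVO, hdV⟩ := exists_mem_countableBasis_ediam_le (hO'.inter hGo') ⟨hw', hG'⟩ n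
  have hcond : Disjoint (closure U) (closure V) ∧ Metric.ediam U ≤ 2⁻¹ ^ n ∧
      Metric.ediam V ≤ 2⁻¹ ^ n :=
    ⟨hGG.mono (closure_mono (hUO.trans inter_subset_right))
      (closure_mono (hVO.trans inter_subset_right)), hdU, hdV⟩
  refine ⟨(⟨U, hU⟩, ⟨V, hV⟩), ?_⟩
  simp only [basicPair, hcond, and_self, if_true, cond_true, cond_false]
  exact ⟨hwU, hwV, hUO.trans inter_subset_left, hVO.trans inter_subset_left⟩

theorem tendsto_two_inv_pow_nhds_zero :
    Tendsto (fun n : ℕ => (2⁻¹ : ENNReal) ^ n) atTop (𝓝 0) :=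
  ENNReal.tendsto_pow_atTop_nhds_zero_of_lt_one (by simp)

end Basis

section LusinNovikov

open TopologicalSpace PiNat

theorem exists_perfect_fiber {W S : Type*} [TopologicalSpace W] [PolishSpace W] [MeasurableSpace W]
    [BorelSpace W] [TopologicalSpace S] [T2Space S] [MeasurableSpace S] [OpensMeasurableSpace S]
    {f : W → S} (hf : Continuous f) (hmeas : Measurable f) (hW : ¬ IsSigmaInj f univ) :
    ∃ h : (ℕ → Bool) → W, Continuous h ∧ Function.Injective h ∧ ∀ x y, f (h x) = f (h y) := by
  let _ := upgradeIsCompletelyMetrizable W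
  have hempty : IsSigmaInj f ∅ := .of_injOn .empty (injOn_empty f)
  have : Nonempty W := by
    by_contra h
    rw [not_nonempty_iff] at h
    exact hW (by rwa [univ_eq_empty_iff.2 h])
  have hK : Nonempty (countableBasis W) := by
    obtain ⟨w⟩ := this
    obtain ⟨U, hU, -⟩ := exists_mem_countableBasis_ediam_le isOpen_univ (mem_univ w) 0
    exact ⟨⟨U, hU⟩⟩
  obtain ⟨p, hp⟩ := exists_splitScheme_not_small hmeas
    (P := basicPair (W := W)) (fun n k b => (isOpen_basicPair n k b).measurableSet)
    (fun n w w' hne => by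
      obtain ⟨k, h1, h2, -⟩ := exists_basicPair isOpen_univ isOpen_univ (mem_univ w) (mem_univ w')
        hne n
      exact ⟨k, h1, h2⟩) hW
  set B := splitScheme (basicPair (W := W)) p
  have hne : ∀ s, (B s).Nonempty := by
    intro s
    by_contra hs
    rw [not_nonempty_iff_eq_empty] at hs
    refine hp s.length ⟨fun r => if r = s then univ else ∅, fun r => by dsimp only; split_ifs <;> simp,
      fun x => ⟨s, rfl, by simp⟩, fun r _ => ?_⟩
    by_cases hr : r = s
    · rw [hr, hs, empty_inter]; exact hempty
    · simpa [hr] using hempty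
  have hsep : ∀ s t : List Bool, s.length = t.length → ∀ O O' : Set S, MeasurableSet O →
      Disjoint O O' → B s ⊆ f ⁻¹' O → B t ⊆ f ⁻¹' O' → False := by
    intro s t hst O O' hO hd hs ht
    have hst' : t ≠ s := by
      rintro rfl
      obtain ⟨w, hw⟩ := hne t
      exact disjoint_left.1 hd (hs hw) (ht hw)
    refine hp s.length ⟨fun r => if r = s then Oᶜ else if r = t then O else ∅,
      fun r => by dsimp only; split_ifs <;> simp [hO], fun x => ?_, fun r _ => ?_⟩
    · by_cases hx : x ∈ O
      · exact ⟨t, hst.symm, by simp [hst', hx]⟩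
      · exact ⟨s, rfl, by simp [hx]⟩
    · refine hempty.mono ?_
      rintro w ⟨hw, hw'⟩
      by_cases hr : r = s
      · subst hr
        simp only [if_true, mem_preimage] at hw'
        exact hw' (hs hw)
      · by_cases hr' : r = t
        · subst hr'
          simp only [hr, if_false, if_true, mem_preimage] at hw'
          exact disjoint_left.1 hd hw' (ht hw)
        · simp [hr, hr'] at hw'
  obtain ⟨h, hc, hinj, hmem⟩ := exists_continuous_injective_of_scheme
    tendsto_two_inv_pow_nhds_zero (B := B) (fun s b => inter_subset_left) hne
    (fun s => (disjoint_closure_basicPair s.length (p s.length s)).mono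
      (closure_mono inter_subset_right) (closure_mono inter_subset_right))
    (fun s b => (Metric.ediam_mono inter_subset_right).trans (ediam_basicPair _ _ b))
  refine ⟨h, hc, hinj, fun x y => ?_⟩
  by_contra hxy
  obtain ⟨O, O', hO, hO', hxO, hyO', hd⟩ := t2_separation hxy
  have key : ∀ x : ℕ → Bool, ∀ G : Set S, IsOpen G → f (h x) ∈ G →
      ∀ᶠ n in atTop, B (res x n) ⊆ f ⁻¹' G := by
    intro x G hG hx
    obtain ⟨δ, hδ, hball⟩ := EMetric.isOpen_iff.1 (hG.preimage hf) (h x) hx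
    have h1 : ∀ᶠ n in atTop, (2⁻¹ : ENNReal) ^ n < δ :=
      tendsto_two_inv_pow_nhds_zero.eventually_lt_const hδ
    obtain ⟨N, hN⟩ := eventually_atTop.1 h1
    refine eventually_atTop.2 ⟨N + 1, fun n hn w hw => hball ?_⟩
    obtain ⟨m, rfl⟩ : ∃ m, n = m + 1 := ⟨n - 1, by omega⟩
    refine lt_of_le_of_lt (Metric.edist_le_ediam_of_mem (subset_closure hw) (hmem x (m + 1))) ?_
    rw [Metric.ediam_closure]
    refine lt_of_le_of_lt ((Metric.ediam_mono inter_subset_right).trans (ediam_basicPair _ _ _)) ?_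
    simpa using hN m (by omega)
  obtain ⟨n, h1, h2⟩ := ((key x O hO hxO).and (key y O' hO' hyO')).exists
  exact hsep _ _ (by simp) O O' hO.measurableSet hd h1 h2

theorem exists_polish_continuous {W S : Type*} [MeasurableSpace W] [StandardBorelSpace W]
    [MeasurableSpace S] [StandardBorelSpace S] {f : W → S} (hf : Measurable f) :
    ∃ (_ : TopologicalSpace W) (_ : TopologicalSpace S), PolishSpace W ∧ BorelSpace W ∧
      PolishSpace S ∧ BorelSpace S ∧ Continuous f := by
  let _ := upgradeStandardBorel S
  let i := upgradeStandardBorel W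
  obtain ⟨t, ht, hcont, hpol⟩ := hf.exists_continuous
  have hb : @BorelSpace W t _ := @BorelSpace.mk W t _ ((eq_borel_upgradeStandardBorel W).trans
    (borel_eq_borel_of_le hpol i.toPolishSpace ht).symm)
  exact ⟨t, _, hpol, hb, inferInstance, inferInstance, hcont⟩

theorem mk_nat_bool : #(ℕ → Bool) = 𝔠 := by simp

theorem not_countable_nat_bool : ¬ Countable (ℕ → Bool) := by
  rw [← Cardinal.mk_le_aleph0_iff, mk_nat_bool, not_le]
  exact Cardinal.aleph0_lt_continuum

theorem isSigmaInj_of_countable_fibers {W S : Type*} [MeasurableSpace W] [StandardBorelSpace W]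
    [MeasurableSpace S] [StandardBorelSpace S] {f : W → S} (hf : Measurable f)
    (hc : ∀ s, (f ⁻¹' {s}).Countable) : IsSigmaInj f univ := by
  obtain ⟨_, _, _, _, _, _, hcont⟩ := exists_polish_continuous hf
  by_contra h
  obtain ⟨g, -, hinj, hg⟩ := exists_perfect_fiber hcont hf h
  have hsub : range g ⊆ f ⁻¹' {f (g fun _ => false)} := by
    rintro _ ⟨x, rfl⟩
    exact hg _ _
  have := (hc _).mono hsub
  have := this.to_subtype
  exact not_countable_nat_bool (rangeFactorization_injective.2 hinj).countable

/-- **Lusin–Novikov**: the domain of a countable-to-one Borel map is a countable disjoint union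
of Borel sets on which the map is injective. -/
theorem exists_disjoint_injOn_cover {W S : Type*} [MeasurableSpace W] [StandardBorelSpace W]
    [MeasurableSpace S] [StandardBorelSpace S] {f : W → S} (hf : Measurable f)
    (hc : ∀ s, (f ⁻¹' {s}).Countable) : ∃ A : ℕ → Set W, (∀ n, MeasurableSet (A n)) ∧
      (∀ n, InjOn f (A n)) ∧ Pairwise (Function.onFun Disjoint A) ∧ ⋃ n, A n = Set.univ := by
  obtain ⟨B, h1, h2, h3⟩ := isSigmaInj_of_countable_fibers hf hc
  refine ⟨disjointed B, MeasurableSet.disjointed h1, fun n => (h2 n).mono (disjointed_subset B n),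
    disjoint_disjointed B, ?_⟩
  rw [iUnion_disjointed]
  exact univ_subset_iff.1 h3

end LusinNovikov

section PerfectSet

open TopologicalSpace PiNat

theorem exists_basicPair_not_countable {V S : Type*} [MetricSpace V] [SecondCountableTopology V]
    [TopologicalSpace S] [T25Space S] {g : V → S} (hg : Continuous g) {A : Set V}
    (hA : ¬ A.Countable) (hinj : InjOn g A) (n : ℕ) :
    ∃ k, (∀ b, ¬ (A ∩ basicPair n k b).Countable) ∧
      Disjoint (g '' closure (basicPair n k false)) (g '' closure (basicPair n k true)) := by
  let N : Set V := ⋃ U ∈ {U ∈ countableBasis V | (A ∩ U).Countable}, U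
  have hN : (A ∩ N).Countable := by
    rw [inter_iUnion₂]
    exact ((countable_countableBasis V).mono (sep_subset _ _)).biUnion fun U hU => hU.2
  have hopen : ∀ x ∈ A \ N, ∀ O, IsOpen O → x ∈ O → ¬ (A ∩ O).Countable := by
    intro x hx O hO hxO hc
    obtain ⟨U, hU, hxU, hUO⟩ := (isBasis_countableBasis V).exists_subset_of_mem_open hxO hO
    exact hx.2 (mem_biUnion (show U ∈ {U ∈ countableBasis V | (A ∩ U).Countable} from
      ⟨hU, hc.mono (inter_subset_inter_right _ hUO)⟩) hxU)
  have hdiff : ¬ (A \ N).Countable := by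
    intro h
    exact hA ((h.union hN).mono (by rw [sdiff_union_inter]))
  have hnt : (A \ N).Nontrivial := by
    by_contra h
    exact hdiff (not_nontrivial_iff.1 h).countable
  obtain ⟨x, hx, y, hy, hxy⟩ := hnt
  have hgxy : g x ≠ g y := fun h => hxy (hinj hx.1 hy.1 h)
  obtain ⟨O, hxO, hO, O', hyO', hO', hOO⟩ := exists_open_nhds_disjoint_closure hgxy
  obtain ⟨k, hk, hk', hkO, hkO'⟩ := exists_basicPair (hO.preimage hg) (hO'.preimage hg) hxO hyO'
    hxy n
  refine ⟨k, ?_, ?_⟩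
  · rintro (_ | _)
    · exact hopen x hx _ (isOpen_basicPair _ _ _) hk
    · exact hopen y hy _ (isOpen_basicPair _ _ _) hk'
  · refine hOO.mono ?_ ?_
    · exact (image_closure_subset_closure_image hg).trans (closure_mono (image_subset_iff.2 hkO))
    · exact (image_closure_subset_closure_image hg).trans (closure_mono (image_subset_iff.2 hkO'))

/-- **Perfect set theorem** for analytic sets. -/
theorem exists_measurableSet_subset_range {V S : Type*} [MeasurableSpace V] [StandardBorelSpace V]
    [MeasurableSpace S] [StandardBorelSpace S] {g : V → S} (hg : Measurable g)
    (hr : ¬ (range g).Countable) : ∃ B ⊆ range g, MeasurableSet B ∧ ¬ B.Countable := by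
  obtain ⟨_, _, _, _, _, _, hcont⟩ := exists_polish_continuous hg
  let _ := upgradeIsCompletelyMetrizable V
  let _ := upgradeIsCompletelyMetrizable S
  let T : Set V := range (fun s : range g => s.2.choose)
  have hTg : ∀ s : range g, g s.2.choose = s := fun s => s.2.choose_spec
  have hTi : InjOn g T := by
    rintro _ ⟨s, rfl⟩ _ ⟨t, rfl⟩ hst
    simp only [hTg] at hst
    rw [Subtype.ext hst]
  have hT : ¬ T.Countable := by
    intro h
    refine hr ((h.image g).mono ?_)
    intro s hs
    exact ⟨_, ⟨⟨s, hs⟩, rfl⟩, hTg ⟨s, hs⟩⟩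
  have step : ∀ (A : {A : Set V // ¬ (T ∩ A).Countable}) (n : ℕ), ∃ k,
      (∀ b, ¬ (T ∩ (A.1 ∩ basicPair n k b)).Countable) ∧
      Disjoint (g '' closure (basicPair n k false)) (g '' closure (basicPair n k true)) := by
    intro A n
    simp only [← inter_assoc]
    exact exists_basicPair_not_countable hcont A.2 (hTi.mono inter_subset_left) n
  choose κ hκ hκd using step
  let B : List Bool → {A : Set V // ¬ (T ∩ A).Countable} := fun l =>
    List.rec ⟨Set.univ, by rwa [inter_univ]⟩
      (fun b s A => ⟨A.1 ∩ basicPair s.length (κ A s.length) b, hκ A s.length b⟩) l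
  have hB : ∀ b s, (B (b :: s)).1 = (B s).1 ∩ basicPair s.length (κ (B s) s.length) b :=
    fun _ _ => rfl
  obtain ⟨h, hc, -, hmem⟩ := exists_continuous_injective_of_scheme
    tendsto_two_inv_pow_nhds_zero (B := fun s => (B s).1)
    (fun s b => inter_subset_left) (fun s => by
      by_contra hs
      have := (B s).2
      rw [not_nonempty_iff_eq_empty.1 hs] at this
      simp at this)
    (fun s => by
      simp only [hB]
      exact (Disjoint.of_image (hκd (B s) s.length)).mono (closure_mono inter_subset_right)
        (closure_mono inter_subset_right))
    (fun s b => (Metric.ediam_mono inter_subset_right).trans (ediam_basicPair _ _ b))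
  have hinj : Function.Injective (g ∘ h) := by
    intro x y hxy
    by_contra hne
    have hres : res x (firstDiff x y) = res y (firstDiff x y) :=
      res_eq_res.2 fun m hm => apply_eq_of_lt_firstDiff hm
    have hd := apply_firstDiff_ne hne
    set n := firstDiff x y
    have hx := hmem x (n + 1)
    have hy := hmem y (n + 1)
    simp only [res_succ, hB, ← hres] at hx hy
    replace hx := closure_mono inter_subset_right hx
    replace hy := closure_mono inter_subset_right hy
    have hD := hκd (B (res x n)) (res x n).length
    cases hxn : x n <;> cases hyn : y n <;> simp only [hxn, hyn] at hx hy hd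
    · exact hd rfl
    · exact disjoint_left.1 hD (mem_image_of_mem g hx) ⟨_, hy, hxy.symm⟩
    · exact disjoint_left.1 hD (mem_image_of_mem g hy) ⟨_, hx, hxy⟩
    · exact hd rfl
  refine ⟨range (g ∘ h), range_comp_subset_range _ _,
    ((hcont.comp hc).measurable.measurableEmbedding hinj).measurableSet_range, fun hcount => ?_⟩
  have := hcount.to_subtype
  exact not_countable_nat_bool (rangeFactorization_injective.2 hinj).countable

theorem measurableSet_injective_continuousMap {W : Type*} [TopologicalSpace W] [T2Space W]
    [MeasurableSpace C(ℕ → Bool, W)] [OpensMeasurableSpace C(ℕ → Bool, W)] :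
    MeasurableSet {h : C(ℕ → Bool, W) | Function.Injective h} := by
  have hcl : ∀ n : ℕ, IsClosed {h : C(ℕ → Bool, W) |
      ∃ p : (ℕ → Bool) × (ℕ → Bool), p.1 n ≠ p.2 n ∧ h p.1 = h p.2} := by
    intro n
    have h1 : IsClosed {q : C(ℕ → Bool, W) × ((ℕ → Bool) × (ℕ → Bool)) |
        q.2.1 n ≠ q.2.2 n ∧ q.1 q.2.1 = q.1 q.2.2} := by
      refine IsClosed.inter ?_ ?_
      · have : Continuous fun q : C(ℕ → Bool, W) × ((ℕ → Bool) × (ℕ → Bool)) =>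
          (q.2.1 n, q.2.2 n) := by fun_prop
        exact (isClosed_discrete {b : Bool × Bool | b.1 ≠ b.2}).preimage this
      · exact isClosed_eq (by fun_prop) (by fun_prop)
    convert isClosedMap_fst_of_compactSpace _ h1 using 1
    ext h
    simp
  have : {h : C(ℕ → Bool, W) | Function.Injective h} = ⋂ n, {h : C(ℕ → Bool, W) |
      ∃ p : (ℕ → Bool) × (ℕ → Bool), p.1 n ≠ p.2 n ∧ h p.1 = h p.2}ᶜ := by
    ext h
    simp only [mem_ofPred, mem_iInter, mem_compl_iff, not_exists, not_and]
    constructor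
    · intro hi n p hp hpp
      exact hp (congrFun (hi hpp) n)
    · intro hn x y hxy
      by_contra hne
      obtain ⟨n, hn'⟩ := Function.ne_iff.1 hne
      exact hn n (x, y) hn' hxy
  rw [this]
  exact MeasurableSet.iInter fun n => (hcl n).measurableSet.compl

theorem exists_measurableSet_uncountable_fibers {W S : Type*} [MeasurableSpace W]
    [StandardBorelSpace W] [MeasurableSpace S] [StandardBorelSpace S] {f : W → S}
    (hf : Measurable f) (hU : ¬ {s | ¬ (f ⁻¹' {s}).Countable}.Countable) :
    ∃ B ⊆ {s | ¬ (f ⁻¹' {s}).Countable}, MeasurableSet B ∧ ¬ B.Countable := by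
  obtain ⟨_, _, _, _, _, _, hcont⟩ := exists_polish_continuous hf
  let _ := upgradeIsCompletelyMetrizable W
  let _ : MeasurableSpace C(ℕ → Bool, W) := borel _
  have : BorelSpace C(ℕ → Bool, W) := ⟨rfl⟩
  let V : Set C(ℕ → Bool, W) := {h | Function.Injective h} ∩ ⋂ x, ⋂ y, {h | f (h x) = f (h y)}
  have hV : MeasurableSet V := measurableSet_injective_continuousMap.inter
    (isClosed_iInter fun x => isClosed_iInter fun y => isClosed_eq (by fun_prop)
      (by fun_prop)).measurableSet
  have : StandardBorelSpace V := hV.standardBorel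
  let g : V → S := fun h => f (h.1 fun _ => false)
  have hg : Measurable g := Measurable.comp (g := fun h : C(ℕ → Bool, W) => f (h fun _ => false))
    (Continuous.measurable (by fun_prop)) measurable_subtype_coe
  have hr : range g = {s | ¬ (f ⁻¹' {s}).Countable} := by
    ext s
    constructor
    · rintro ⟨⟨h, hi, hh⟩, rfl⟩ hc
      have hsub : range h ⊆ f ⁻¹' {g ⟨h, hi, hh⟩} := by
        rintro _ ⟨x, rfl⟩
        exact mem_iInter.1 (mem_iInter.1 hh x) _
      have := (hc.mono hsub).to_subtype
      exact not_countable_nat_bool (rangeFactorization_injective.2 hi).countable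
    · intro hs
      obtain ⟨h, h1, h2, h3⟩ := ((isClosed_singleton (x := s)).preimage
        hcont).exists_nat_bool_injection_of_not_countable hs
      have h4 : ∀ x, f (h x) = s := fun x => h1 (mem_range_self x)
      exact ⟨⟨⟨h, h2⟩, h3, by simp [h4]⟩, h4 _⟩
  rw [← hr] at hU ⊢
  exact exists_measurableSet_subset_range hg hU

end PerfectSet

section NonUniformizable

open PiNat

/-- The point `z` codes two trees, indexed by `a : Bool`, of (reversed) finite sequences;
membership of `s` in a tree consults `z` about its own first bits. -/
def InTree (a : Bool) (z : ℕ → Bool) (s : List ℕ) : Prop :=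
  ∀ i < s.length, z (Encodable.encode (a, s, i, z i)) = true

/-- `G` is a simulation of the tree `a` of `z` by its tree `b`. -/
def IsSimulation (a b : Bool) (z : ℕ → Bool) (G : List ℕ → List ℕ → Prop) : Prop :=
  ∀ s t, G s t → ∀ m, InTree a z (m :: s) → ∃ n, InTree b z (n :: t) ∧ G (m :: s) (n :: t)

/-- The tree `a` of `z` has an infinite branch. -/
def HasBranch (a : Bool) (z : ℕ → Bool) : Prop := ∃ y : ℕ → ℕ, ∀ n, InTree a z (res y n)

theorem exists_simulation_or_compl (z : ℕ → Bool) : ∃ G : List ℕ → List ℕ → Prop,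
    IsSimulation true false z G ∧ IsSimulation false true z fun t s => ¬ G s t := by
  let M : List ℕ → List ℕ → Prop := fun s t => ∃ G, IsSimulation true false z G ∧ G s t
  have hM : IsSimulation true false z M := by
    rintro s t ⟨G, hG, hst⟩ m hm
    obtain ⟨n, hn, hmn⟩ := hG s t hst m hm
    exact ⟨n, hn, G, hG, hmn⟩
  refine ⟨M, hM, fun t s hst n hn => ?_⟩
  by_contra! h
  refine hst ⟨fun s' t' => M s' t' ∨ (s' = s ∧ t' = t), ?_, Or.inr ⟨rfl, rfl⟩⟩
  rintro s' t' (hM' | ⟨rfl, rfl⟩) m hm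
  · obtain ⟨n, hn, hmn⟩ := hM s' t' hM' m hm
    exact ⟨n, hn, Or.inl hmn⟩
  · exact ⟨n, hn, Or.inl (h m hm)⟩

theorem IsSimulation.hasBranch {a b : Bool} {z : ℕ → Bool} {G : List ℕ → List ℕ → Prop}
    (hG : IsSimulation a b z G) (h0 : G [] []) (ha : HasBranch a z) : HasBranch b z := by
  obtain ⟨y, hy⟩ := ha
  have step : ∀ n (t : {t // G (res y n) t}), ∃ k, InTree b z (k :: t.1) ∧
      G (res y (n + 1)) (k :: t.1) := by
    intro n t
    have := hG _ _ t.2 (y n) (by simpa only [res_succ] using hy (n + 1))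
    simpa only [res_succ] using this
  choose κ hκ hκ' using step
  let τ : ∀ n, {t // G (res y n) t} := fun n =>
    Nat.rec ⟨[], by simpa using h0⟩ (fun n t => ⟨κ n t :: t.1, hκ' n t⟩) n
  have hτ : ∀ n, (τ (n + 1)).1 = κ n (τ n) :: (τ n).1 := fun _ => rfl
  have hres : ∀ n, res (fun n => κ n (τ n)) n = (τ n).1 := by
    intro n
    induction n with
    | zero => rfl
    | succ n ih => rw [res_succ, ih, hτ]
  refine ⟨fun n => κ n (τ n), fun n => ?_⟩
  rw [hres]
  cases n with
  | zero => intro i hi; exact absurd hi (Nat.not_lt_zero i)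
  | succ n => rw [hτ]; exact hκ n (τ n)

theorem exists_tree_code {D : Set (ℕ → Bool)} (hD : AnalyticSet D) :
    ∃ c : List ℕ → ℕ → Bool → Bool, ∀ z, z ∈ D ↔
      ∃ y : ℕ → ℕ, ∀ n, ∀ i < n, c (res y n) i (z i) = true := by
  classical
  rw [AnalyticSet] at hD
  rcases hD with rfl | ⟨f, hf, rfl⟩
  · exact ⟨fun _ _ _ => false, fun z => by
      simp only [mem_empty_iff_false, Bool.false_eq_true, imp_false, false_iff, not_exists,
        not_forall, not_not]
      exact fun _ => ⟨1, 0, by simp⟩⟩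
  · refine ⟨fun s i b => decide (∃ y, res y s.length = s ∧ f y i = b), fun z => ?_⟩
    simp only [decide_eq_true_eq, res_length]
    constructor
    · rintro ⟨y, rfl⟩
      exact ⟨y, fun n i _ => ⟨y, rfl, rfl⟩⟩
    · rintro ⟨y, hy⟩
      refine ⟨y, funext fun i => ?_⟩
      have hopen : IsOpen {y' | f y' i = f y i} :=
        (isOpen_discrete {f y i}).preimage ((continuous_apply i).comp hf)
      obtain ⟨n, hn⟩ : ∃ n, cylinder y n ⊆ {y' | f y' i = f y i} := by
        have := (isTopologicalBasis_cylinders (E := fun _ : ℕ => ℕ)).exists_subset_of_mem_open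
          (show y ∈ {y' | f y' i = f y i} from rfl) hopen
        obtain ⟨_, ⟨x, n, rfl⟩, hyx, hsub⟩ := this
        exact ⟨n, by rwa [mem_cylinder_iff_eq.1 hyx]⟩
      obtain ⟨y', h1, h2⟩ := hy (max n (i + 1)) i (by omega)
      have h3 : y' ∈ cylinder y n := by
        have : y' ∈ cylinder y (max n (i + 1)) := by rw [cylinder_eq_res]; exact h1
        exact cylinder_anti y (le_max_left _ _) this
      rw [← h2]
      exact (hn h3).symm

instance : PolishSpace (ℕ → Bool) where

theorem exists_hasBranch_iff {D : Set (ℕ → Bool)} (hD : MeasurableSet D) :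
    ∃ z, (HasBranch true z ↔ z ∈ D) ∧ (HasBranch false z ↔ z ∉ D) := by
  obtain ⟨c, hc⟩ := exists_tree_code hD.analyticSet
  obtain ⟨c', hc'⟩ := exists_tree_code hD.compl.analyticSet
  let z : ℕ → Bool := Function.extend Encodable.encode
    (fun q : Bool × List ℕ × ℕ × Bool => cond q.1 (c q.2.1 q.2.2.1 q.2.2.2)
      (c' q.2.1 q.2.2.1 q.2.2.2)) fun _ => false
  have hz : ∀ q : Bool × List ℕ × ℕ × Bool, z (Encodable.encode q) =
      cond q.1 (c q.2.1 q.2.2.1 q.2.2.2) (c' q.2.1 q.2.2.1 q.2.2.2) :=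
    fun q => Encodable.encode_injective.extend_apply _ _ _
  refine ⟨z, ?_, ?_⟩
  · rw [hc]
    simp only [HasBranch, InTree, hz, cond_true, res_length]
  · rw [← mem_compl_iff, hc']
    simp only [HasBranch, InTree, hz, cond_false, res_length]

/-- Pairs of a code `z` and a relation that is a simulation between the trees of `z`, or whose
complement is one in the other direction, according to its value at the roots. -/
def simulationSet : Set ((ℕ → Bool) × (List ℕ × List ℕ → Bool)) :=
  {q | (q.2 ([], []) = true ∧ IsSimulation true false q.1 fun s t => q.2 (s, t) = true) ∨
    (q.2 ([], []) = false ∧ IsSimulation false true q.1 fun t s => q.2 (s, t) = false)}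

theorem measurable_inTree (a : Bool) (s : List ℕ) : Measurable fun z => InTree a z s := by
  have h : ∀ z, InTree a z s ↔
      ∀ i, i < s.length → ∃ b, z i = b ∧ z (Encodable.encode (a, s, i, b)) = true := by
    intro z; simp [InTree]
  simp only [h]
  have hz : ∀ (n : ℕ) (b : Bool), Measurable fun z : ℕ → Bool => z n = b := fun n b => by
    have : MeasurableSet {z : ℕ → Bool | z n = b} :=
      measurableSet_eq_fun (measurable_pi_apply n) measurable_const
    exact measurableSet_setOfPred.1 this
  exact Measurable.forall fun i => Measurable.imp measurable_const
    (Measurable.exists fun b => (hz _ _).and (hz _ _))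

theorem measurableSet_simulationSet : MeasurableSet simulationSet := by
  have hG : ∀ p b, Measurable fun q : (ℕ → Bool) × (List ℕ × List ℕ → Bool) => q.2 p = b :=
    fun p b => by
      have : MeasurableSet {q : (ℕ → Bool) × (List ℕ × List ℕ → Bool) | q.2 p = b} :=
        measurableSet_eq_fun ((measurable_pi_apply p).comp measurable_snd) measurable_const
      exact measurableSet_setOfPred.1 this
  have hT : ∀ a s, Measurable fun q : (ℕ → Bool) × (List ℕ × List ℕ → Bool) => InTree a q.1 s :=
    fun a s => (measurable_inTree a s).comp measurable_fst
  unfold simulationSet IsSimulation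
  rw [measurableSet_setOfPred]
  refine Measurable.or ((hG _ _).and ?_) ((hG _ _).and ?_)
  all_goals
    exact Measurable.forall fun s => Measurable.forall fun t => (hG _ _).imp <|
      Measurable.forall fun m => (hT _ _).imp <| Measurable.exists fun n => (hT _ _).and (hG _ _)

/-- There is a Borel surjection onto the Cantor space without a Borel section. -/
theorem exists_surjective_not_exists_section :
    ∃ (Q : Type) (_ : MeasurableSpace Q) (_ : StandardBorelSpace Q) (q : Q → ℕ → Bool),
      Measurable q ∧ Function.Surjective q ∧
        ¬ ∃ k : (ℕ → Bool) → Q, Measurable k ∧ ∀ z, q (k z) = z := by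
  classical
  refine ⟨simulationSet, inferInstance, measurableSet_simulationSet.standardBorel,
    fun q => q.1.1, measurable_fst.comp measurable_subtype_coe, fun z => ?_, ?_⟩
  · obtain ⟨G, hG, hG'⟩ := exists_simulation_or_compl z
    by_cases h : G [] []
    · exact ⟨⟨(z, fun p => decide (G p.1 p.2)), Or.inl (by simpa [h] using hG)⟩, rfl⟩
    · exact ⟨⟨(z, fun p => decide (G p.1 p.2)), Or.inr (by simpa [h] using hG')⟩, rfl⟩
  · rintro ⟨k, hk, hkz⟩
    have hD : MeasurableSet {z | (k z).1.2 ([], []) = true} :=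
      ((measurable_pi_apply _).comp (measurable_snd.comp (measurable_subtype_coe.comp hk)))
        (measurableSet_singleton true)
    obtain ⟨z, h1, h2⟩ := exists_hasBranch_iff hD
    have hz : (k z).1.1 = z := hkz z
    rcases (k z).2 with ⟨h0, hs⟩ | ⟨h0, hs⟩
    · rw [hz] at hs
      exact h2.1 (hs.hasBranch h0 (h1.2 h0)) h0
    · rw [hz] at hs
      have hn : z ∉ {z | (k z).1.2 ([], []) = true} := by simp [h0]
      exact hn (h1.1 (hs.hasBranch h0 (h2.2 hn)))

end NonUniformizable

section StandardBorel

theorem _root_.MeasurableEquiv.standardBorelSpace {α β : Type*} [MeasurableSpace α]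
    [MeasurableSpace β] [StandardBorelSpace β] (e : α ≃ᵐ β) : StandardBorelSpace α := by
  let _ := upgradeStandardBorel β
  let _ : TopologicalSpace α := TopologicalSpace.induced e inferInstance
  have : PolishSpace α := e.toEquiv.polishSpace_induced
  have : BorelSpace α := e.measurableEmbedding.borelSpace ⟨rfl⟩
  infer_instance

theorem _root_.MeasurableEmbedding.standardBorelSpace {α β : Type*} [MeasurableSpace α]
    [MeasurableSpace β] [StandardBorelSpace β] {f : α → β} (hf : MeasurableEmbedding f) :
    StandardBorelSpace α :=
  have := hf.measurableSet_range.standardBorel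
  hf.equivRange.standardBorelSpace

instance {α : Type*} [MeasurableSpace α] [StandardBorelSpace α] :
    StandardBorelSpace (ULift α) :=
  MeasurableEquiv.ulift.standardBorelSpace

instance {α β : Type*} [MeasurableSpace α] [StandardBorelSpace α] [MeasurableSpace β]
    [StandardBorelSpace β] : StandardBorelSpace (α ⊕ β) := by
  obtain ⟨e, he⟩ := exists_measurableEmbedding_real α
  obtain ⟨e', he'⟩ := exists_measurableEmbedding_real β
  let f : α ⊕ β → Bool × ℝ := Sum.elim (fun a => (false, e a)) fun b => (true, e' b)
  have hf : MeasurableEmbedding f := by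
    refine ⟨?_, ?_, fun {s} hs => ?_⟩
    · rintro (a | a) (b | b) hab
      · rw [he.injective (congrArg Prod.snd hab)]
      · simp [f] at hab
      · simp [f] at hab
      · rw [he'.injective (congrArg Prod.snd hab)]
    · exact measurable_fun_sum (measurable_const.prodMk he.measurable)
        (measurable_const.prodMk he'.measurable)
    · have : f '' s = {false} ×ˢ (e '' (Sum.inl ⁻¹' s)) ∪ {true} ×ˢ (e' '' (Sum.inr ⁻¹' s)) := by
        ext ⟨b, x⟩
        cases b <;> simp [f]
      rw [this]
      exact ((measurableSet_singleton _).prod (he.measurableSet_image.2 (measurable_inl hs))).union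
        ((measurableSet_singleton _).prod (he'.measurableSet_image.2 (measurable_inr hs)))
  exact hf.standardBorelSpace

theorem mk_eq_continuum {α : Type u} [MeasurableSpace α] [StandardBorelSpace α]
    (h : ¬ Countable α) : #α = 𝔠 := by
  have := Cardinal.lift_mk_eq'.2 ⟨(PolishSpace.measurableEquivNatBoolOfNotCountable h).toEquiv⟩
  rw [mk_nat_bool, Cardinal.lift_continuum, Cardinal.lift_uzero] at this
  exact this

theorem mk_eq_continuum_of_not_countable {α : Type u} [MeasurableSpace α] [StandardBorelSpace α]
    {s : Set α} (hs : MeasurableSet s) (h : ¬ s.Countable) : #s = 𝔠 :=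
  have := hs.standardBorel
  mk_eq_continuum h

end StandardBorel

section Parametrization

theorem countable_CPlus : CPlus.{u}.Countable := by
  refine ((countable_range ((↑) : ℕ → Cardinal.{u})).union
    ((countable_singleton ℵ₀).union (countable_singleton 𝔠))).mono ?_
  rintro m ⟨-, hm | rfl⟩
  · rcases hm.lt_or_eq with h | rfl
    · obtain ⟨n, rfl⟩ := Cardinal.lt_aleph0.1 h
      exact Or.inl ⟨n, rfl⟩
    · exact Or.inr (Or.inl rfl)
  · exact Or.inr (Or.inr rfl)

theorem mk_fiber_mem_CPlus {W S : Type u} [MeasurableSpace W] [StandardBorelSpace W]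
    [MeasurableSpace S] [MeasurableSingletonClass S] {f : W → S} (hf : Measurable f) (w : W) :
    #(f ⁻¹' {f w}) ∈ CPlus.{u} := by
  refine ⟨Cardinal.mk_ne_zero_iff.2 ⟨⟨w, rfl⟩⟩, ?_⟩
  by_cases h : (f ⁻¹' {f w}).Countable
  · exact Or.inl (Cardinal.le_aleph0_iff_set_countable.2 h)
  · exact Or.inr (mk_eq_continuum_of_not_countable (hf (measurableSet_singleton _)) h)

/-- A parametrization of the part of the domain of `f` where the fibers have size `m`. -/
def FiberParametrized {W S : Type u} [MeasurableSpace W] (f : W → S) (m : Cardinal.{u}) : Prop :=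
  MeasurableSet {w | #(f ⁻¹' {f w}) = m} ∧
  ∃ (Z Y : Type u) (_ : MeasurableSpace Z) (_ : StandardBorelSpace Z)
    (_ : MeasurableSpace Y) (_ : StandardBorelSpace Y) (φ : {w | #(f ⁻¹' {f w}) = m} → Z × Y),
    #Y = m ∧ Measurable φ ∧ Function.Bijective φ ∧
      ∀ x y : {w | #(f ⁻¹' {f w}) = m}, f x = f y ↔ (φ x).1 = (φ y).1

theorem borelParametrized_of_fiberParametrized {W S : Type u} [MeasurableSpace W]
    [StandardBorelSpace W] [MeasurableSpace S] [MeasurableSingletonClass S] {f : W → S}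
    (hf : Measurable f) (h : ∀ m ∈ CPlus.{u}, FiberParametrized f m) :
    BorelParametrized (Setoid.ker f) := by
  choose hm Z Y mZ sZ mY sY φ hY hφm hφb hφ using fun m : CPlus.{u} => h m m.2
  have : Countable CPlus.{u} := countable_CPlus.to_subtype
  let κ : W → CPlus.{u} := fun w => ⟨#(f ⁻¹' {f w}), mk_fiber_mem_CPlus hf w⟩
  let Φ : W → Σ m : CPlus.{u}, Z m × Y m := fun w => ⟨κ w, φ (κ w) ⟨w, rfl⟩⟩
  have hΦ : ∀ (m : CPlus.{u}) (w : W) (hw : #(f ⁻¹' {f w}) = m), Φ w = ⟨m, φ m ⟨w, hw⟩⟩ := by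
    intro m w hw
    obtain rfl : κ w = m := Subtype.ext hw
    rfl
  refine ⟨Z, Y, mZ, sZ, mY, sY, Φ, hY, ?_, ⟨?_, ?_⟩, ?_⟩
  · intro s hs
    have : Φ ⁻¹' s = ⋃ m : CPlus.{u}, Subtype.val '' (φ m ⁻¹' ((fun p => (⟨m, p⟩ : Σ m : CPlus.{u}, Z m × Y m)) ⁻¹' s)) := by
      ext w
      rw [mem_iUnion]
      constructor
      · exact fun hw => ⟨κ w, ⟨w, rfl⟩, hw, rfl⟩
      · rintro ⟨m, ⟨w, hw⟩, hs, rfl⟩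
        rw [mem_preimage, hΦ m w hw]
        exact hs
    rw [this]
    refine MeasurableSet.iUnion fun m => (hm m).subtype_image (hφm m ?_)
    exact MeasurableSpace.measurableSet_iInf.1 hs m
  · intro x y hxy
    have hx := hΦ (κ x) x rfl
    have hκ : κ y = κ x := congrArg Sigma.fst hxy.symm
    have hy := hΦ (κ x) y (congrArg Subtype.val hκ)
    rw [hxy, hy] at hx
    simp only [Sigma.mk.injEq, heq_eq_eq, true_and] at hx
    exact (congrArg Subtype.val ((hφb (κ x)).1 hx)).symm
  · rintro ⟨m, p⟩
    obtain ⟨⟨w, hw⟩, rfl⟩ := (hφb m).2 p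
    exact ⟨w, hΦ m w hw⟩
  · intro x y
    rw [Setoid.ker_def]
    constructor
    · intro hxy
      have hκ : κ y = κ x := Subtype.ext (by simp only [κ, hxy])
      have hy := hΦ (κ x) y (congrArg Subtype.val hκ)
      rw [hy]
      have := (hφ (κ x) ⟨x, rfl⟩ ⟨y, congrArg Subtype.val hκ⟩).1 hxy
      simp only [Φ, this]
    · intro hxy
      have hκ : κ y = κ x := (congrArg Sigma.fst hxy).symm
      have hy := hΦ (κ x) y (congrArg Subtype.val hκ)
      rw [hy] at hxy
      simp only [Φ, Sigma.mk.injEq, heq_eq_eq, true_and] at hxy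
      exact (hφ (κ x) ⟨x, rfl⟩ ⟨y, congrArg Subtype.val hκ⟩).2 hxy

theorem fiberParametrized_continuum {W S : Type u} [MeasurableSpace W] [StandardBorelSpace W]
    [MeasurableSpace S] [StandardBorelSpace S] {f : W → S} (hf : Measurable f)
    (hU : {s | ¬ (f ⁻¹' {s}).Countable}.Countable) : FiberParametrized f 𝔠 := by
  set U : Set S := {s | ¬ (f ⁻¹' {s}).Countable} with hUdef
  have hUm : MeasurableSet U := hU.measurableSet
  have hmem : ∀ s, s ∈ U ↔ #(f ⁻¹' {s}) = 𝔠 := by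
    intro s
    constructor
    · exact fun hs => mk_eq_continuum_of_not_countable (hf (measurableSet_singleton _)) hs
    · intro hs hc
      rw [← Cardinal.le_aleph0_iff_set_countable, hs] at hc
      exact absurd hc (not_le.2 Cardinal.aleph0_lt_continuum)
  have hfib : ∀ s : U, MeasurableSet (f ⁻¹' {s.1}) := fun s => hf (measurableSet_singleton _)
  have hst : ∀ s : U, StandardBorelSpace (f ⁻¹' {s.1}) := fun s => (hfib s).standardBorel
  let e : ∀ s : U, (f ⁻¹' {s.1}) ≃ᵐ (ℕ → Bool) := fun s =>
    PolishSpace.measurableEquivNatBoolOfNotCountable s.2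
  have hW : {w | #(f ⁻¹' {f w}) = 𝔠} = f ⁻¹' U := by
    ext w; exact (hmem _).symm
  have := hU.to_subtype
  have := hUm.standardBorel
  let σ : {w | #(f ⁻¹' {f w}) = 𝔠} → U := fun w => ⟨f w, (hmem _).2 w.2⟩
  let φ : {w | #(f ⁻¹' {f w}) = 𝔠} → U × ULift.{u} (ℕ → Bool) :=
    fun w => (σ w, ULift.up (e (σ w) ⟨w.1, rfl⟩))
  have hφ : ∀ (w : {w | #(f ⁻¹' {f w}) = 𝔠}) (s : U) (h : f w.1 = s.1),
      φ w = (s, ULift.up (e s ⟨w.1, h⟩)) := by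
    intro w s h
    obtain rfl : σ w = s := Subtype.ext h
    rfl
  refine ⟨hW ▸ hf hUm, U, ULift.{u} (ℕ → Bool), inferInstance, inferInstance, inferInstance,
    inferInstance, φ, by simp, ?_, ⟨?_, ?_⟩, ?_⟩
  · intro T hT
    have : φ ⁻¹' T = ⋃ s : U, Subtype.val ⁻¹' (Subtype.val ''
        (e s ⁻¹' ((fun b => (s, ULift.up b)) ⁻¹' T))) := by
      ext w
      simp only [mem_preimage, mem_iUnion, mem_image, Subtype.exists, exists_and_right,
        exists_eq_right]
      constructor
      · exact fun hw => ⟨(σ w).1, (σ w).2, rfl, hw⟩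
      · rintro ⟨s, hs, hw, h⟩
        rwa [hφ w ⟨s, hs⟩ hw]
    rw [this]
    refine MeasurableSet.iUnion fun s => measurable_subtype_coe ((hfib s).subtype_image
      ((e s).measurable ?_))
    exact (measurable_const.prodMk measurable_up) hT
  · intro x y hxy
    have h1 : f x.1 = f y.1 := congrArg (fun p => p.1.1) hxy
    rw [hφ y (σ x) h1.symm] at hxy
    have h2 := congrArg (fun p => p.2.down) hxy
    have h3 := (e (σ x)).injective h2
    exact Subtype.ext ((congrArg Subtype.val h3 :))
  · rintro ⟨s, ⟨b⟩⟩
    obtain ⟨⟨w, hw⟩, rfl⟩ := (e s).surjective b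
    have hws : f w = s.1 := hw
    have hws' : #(f ⁻¹' {f w}) = 𝔠 := by rw [hws]; exact (hmem _).1 s.2
    exact ⟨⟨w, hws'⟩, hφ ⟨w, hws'⟩ s hw⟩
  · intro x y
    exact ⟨fun h => Subtype.ext h, fun h => congrArg Subtype.val h⟩

theorem natCast_lt_mk_iff {K : Set ℕ} [DecidablePred (· ∈ K)] (i : ℕ) :
    (i : Cardinal) < #K ↔ ∃ n ∈ K, Nat.count (· ∈ K) n = i := by
  have h : (i : Cardinal) < #K ↔ ∀ hf : {n | n ∈ K}.Finite, i < hf.toFinset.card := by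
    by_cases hK : K.Finite
    · have := hK.fintype
      rw [Cardinal.mk_fintype, Nat.cast_lt, ← Set.toFinset_card]
      refine ⟨fun h hf => ?_, fun h => ?_⟩
      · convert h using 2
        ext; simp
      · convert h hK using 2
        ext; simp
    · have := Set.Infinite.to_subtype hK
      rw [Cardinal.mk_eq_aleph0]
      exact ⟨fun _ hf => absurd hf hK, fun _ => Cardinal.natCast_lt_aleph0⟩
  rw [h]
  constructor
  · exact fun hi => ⟨Nat.nth (· ∈ K) i, Nat.nth_mem i hi, Nat.count_nth hi⟩
  · rintro ⟨n, hn, rfl⟩ hf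
    exact Nat.count_lt_card hf hn

theorem eq_of_forall_natCast_lt_iff {a b : Cardinal.{u}} (ha : a ≤ ℵ₀) (hb : b ≤ ℵ₀)
    (h : ∀ i : ℕ, (i : Cardinal.{u}) < a ↔ (i : Cardinal.{u}) < b) : a = b := by
  have key : ∀ {a b : Cardinal.{u}}, a ≤ ℵ₀ →
      (∀ i : ℕ, (i : Cardinal.{u}) < a → (i : Cardinal.{u}) < b) → a ≤ b := by
    intro a b ha h
    by_contra! hlt
    obtain ⟨n, rfl⟩ := Cardinal.lt_aleph0.1 (hlt.trans_le ha)
    exact lt_irrefl _ (h n hlt)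
  exact le_antisymm (key ha fun i => (h i).1) (key hb fun i => (h i).2)

theorem mk_natCast_lt {m : Cardinal.{u}} (hm : m ≤ ℵ₀) :
    #(ULift.{u} {i : ℕ // (i : Cardinal.{u}) < m}) = m := by
  rw [Cardinal.mk_uLift]
  rcases hm.lt_or_eq with h | rfl
  · obtain ⟨n, rfl⟩ := Cardinal.lt_aleph0.1 h
    have : {i : ℕ // (i : Cardinal.{u}) < n} ≃ Fin n :=
      (Equiv.subtypeEquivRight fun i => by simp).trans Fin.equivSubtype.symm
    rw [Cardinal.mk_congr this]; simp
  · have : {i : ℕ // (i : Cardinal.{u}) < ℵ₀} ≃ ℕ :=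
      Equiv.subtypeUnivEquiv fun i => Cardinal.natCast_lt_aleph0
    rw [Cardinal.mk_congr this]; simp

theorem fiberParametrized_of_le_aleph0 {W S : Type u} [MeasurableSpace W] [StandardBorelSpace W]
    [MeasurableSpace S] [StandardBorelSpace S] {f : W → S} (hf : Measurable f)
    (hU : {s | ¬ (f ⁻¹' {s}).Countable}.Countable) {m : Cardinal.{u}}
    (hm : m ≤ ℵ₀) : FiberParametrized f m := by
  classical
  set U : Set S := {s | ¬ (f ⁻¹' {s}).Countable} with hUdef
  have hUm : MeasurableSet U := hU.measurableSet
  have hUW : MeasurableSet (f ⁻¹' Uᶜ) := hf hUm.compl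
  have := hUW.standardBorel
  obtain ⟨A', hA'm, hA'i, hA'd, hA'u⟩ := exists_disjoint_injOn_cover
    (f := fun w : f ⁻¹' Uᶜ => f w) (hf.comp measurable_subtype_coe) (fun s => by
      by_cases hs : s ∈ U
      · convert countable_empty
        ext ⟨w, hw⟩
        simp only [mem_preimage, mem_singleton_iff, mem_empty_iff_false, iff_false]
        rintro rfl
        exact hw hs
      · have : (f ⁻¹' {s}).Countable := not_not.1 hs
        exact this.preimage Subtype.val_injective)
  let A : ℕ → Set W := fun n => Subtype.val '' A' n
  have hA : ∀ n, MeasurableSet (A n) := fun n => hUW.subtype_image (hA'm n)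
  have hAi : ∀ n, InjOn f (A n) := by
    rintro n _ ⟨x, hx, rfl⟩ _ ⟨y, hy, rfl⟩ hxy
    rw [hA'i n hx hy hxy]
  have hAd : ∀ n n' w, w ∈ A n → w ∈ A n' → n = n' := by
    rintro n n' _ ⟨x, hx, rfl⟩ ⟨y, hy, hyx⟩
    by_contra hne
    exact disjoint_left.1 (hA'd hne) hx (Subtype.ext hyx ▸ hy)
  have hAu : ∀ w, f w ∉ U → ∃ n, w ∈ A n := by
    intro w hw
    obtain ⟨n, hn⟩ := mem_iUnion.1 (hA'u.symm ▸ mem_univ (⟨w, hw⟩ : f ⁻¹' Uᶜ))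
    exact ⟨n, _, hn, rfl⟩
  choose idx hidx using hAu
  let P : ℕ → Set S := fun n => f '' A n
  have hP : ∀ n, MeasurableSet (P n) := fun n => (hA n).image_of_measurable_injOn hf (hAi n)
  have hcount : ∀ n, Measurable fun s => Nat.count (fun j => s ∈ P j) n := by
    intro n
    induction n with
    | zero => simp
    | succ n ih =>
      simp only [Nat.count_succ]
      exact ih.add (Measurable.ite (hP n) measurable_const measurable_const)
  have hlt : ∀ s, s ∉ U → ∀ i : ℕ, (i : Cardinal.{u}) < #(f ⁻¹' {s}) ↔
      ∃ n, s ∈ P n ∧ Nat.count (fun j => s ∈ P j) n = i := by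
    intro s hs i
    have hsU : ∀ w : f ⁻¹' {s}, f w ∉ U := by
      rintro ⟨w, rfl⟩; exact hs
    let ψ : f ⁻¹' {s} → {n | s ∈ P n} := fun w =>
      ⟨idx w (hsU w), w, hidx _ _, w.2⟩
    have hψ : Function.Bijective ψ := by
      constructor
      · intro x y hxy
        have h1 : idx x (hsU x) = idx y (hsU y) := congrArg Subtype.val hxy
        exact Subtype.ext (hAi _ (hidx x (hsU x)) (h1 ▸ hidx y (hsU y)) (x.2.trans y.2.symm))
      · rintro ⟨n, w, hw, hws⟩
        exact ⟨⟨w, hws⟩, Subtype.ext (hAd _ _ w (hidx _ _) hw)⟩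
    have h1 := Cardinal.lift_mk_eq'.2 ⟨Equiv.ofBijective ψ hψ⟩
    rw [Cardinal.lift_uzero] at h1
    rw [h1, Cardinal.nat_lt_lift_iff, natCast_lt_mk_iff]
    rfl
  have hle : ∀ s, s ∉ U → #(f ⁻¹' {s}) ≤ ℵ₀ := fun s hs =>
    Cardinal.le_aleph0_iff_set_countable.2 (not_not.1 hs)
  have hnU : ∀ s, #(f ⁻¹' {s}) = m → s ∉ U := fun s hs hsU =>
    hsU (Cardinal.le_aleph0_iff_set_countable.1 (hs.trans_le hm))
  let Z : Set S := {s | #(f ⁻¹' {s}) = m}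
  have hZ : MeasurableSet Z := by
    have : Z = Uᶜ ∩ ⋂ i : ℕ, {s | (i : Cardinal.{u}) < m ↔
        ∃ n, s ∈ P n ∧ Nat.count (fun j => s ∈ P j) n = i} := by
      ext s
      simp only [Z, mem_inter_iff, mem_compl_iff, mem_iInter, mem_ofPred]
      constructor
      · exact fun h => ⟨hnU s h, fun i => by rw [← hlt s (hnU s h), h]⟩
      · rintro ⟨h1, h2⟩
        exact eq_of_forall_natCast_lt_iff (hle s h1) hm fun i => by rw [hlt s h1, h2]
    rw [this]
    refine hUm.compl.inter (MeasurableSet.iInter fun i => ?_)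
    rw [measurableSet_setOfPred]
    refine Measurable.iff measurable_const (Measurable.exists fun n => ?_)
    have h1 : MeasurableSet {s | Nat.count (fun j => s ∈ P j) n = i} :=
      measurableSet_eq_fun (hcount n) measurable_const
    exact (hP n).mem.and (measurableSet_setOfPred.1 h1)
  have := hZ.standardBorel
  let Y : Type u := ULift.{u} {i : ℕ // (i : Cardinal.{u}) < m}
  have hwU : ∀ w : {w | #(f ⁻¹' {f w}) = m}, f w ∉ U := fun w => hnU _ w.2
  let ρ : {w | #(f ⁻¹' {f w}) = m} → Y := fun w =>
    ULift.up ⟨Nat.count (fun j => f w ∈ P j) (idx w (hwU w)), by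
      have h1 := (hlt (f w) (hwU w) _).2 ⟨idx w (hwU w), ⟨w, hidx _ _, rfl⟩, rfl⟩
      exact h1.trans_eq w.2⟩
  have hρ : ∀ (w : {w | #(f ⁻¹' {f w}) = m}) (n : ℕ), w.1 ∈ A n → ∀ y : Y,
      ρ w = y ↔ Nat.count (fun j => f w ∈ P j) n = y.down := by
    intro w n hn y
    obtain rfl := hAd _ _ _ (hidx w (hwU w)) hn
    exact ⟨fun h => congrArg (fun y : Y => y.down.1) h,
      fun h => congrArg ULift.up (Subtype.ext h)⟩
  refine ⟨hf hZ, Z, Y, inferInstance, inferInstance, inferInstance, inferInstance,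
    fun w => (⟨f w, w.2⟩, ρ w), mk_natCast_lt hm, ?_, ⟨?_, ?_⟩, ?_⟩
  · refine ((hf.comp measurable_subtype_coe).subtype_mk).prodMk (measurable_to_countable' ?_)
    intro y
    have : ρ ⁻¹' {y} = ⋃ n, Subtype.val ⁻¹' (A n) ∩
        {w | Nat.count (fun j => f w ∈ P j) n = y.down} := by
      ext w
      simp only [mem_preimage, mem_singleton_iff, mem_iUnion, mem_inter_iff, mem_ofPred]
      constructor
      · exact fun h => ⟨_, hidx w (hwU w), (hρ w _ (hidx w (hwU w)) y).1 h⟩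
      · rintro ⟨n, hn, h⟩
        exact (hρ w n hn y).2 h
    rw [this]
    exact MeasurableSet.iUnion fun n => (measurable_subtype_coe (hA n)).inter
      (measurableSet_eq_fun ((hcount n).comp (hf.comp measurable_subtype_coe)) measurable_const)
  · intro x y hxy
    have h1 : f x = f y := congrArg (fun p => p.1.1) hxy
    have h2 : Nat.count (fun j => f x ∈ P j) (idx x (hwU x)) =
        Nat.count (fun j => f y ∈ P j) (idx y (hwU y)) := congrArg (fun p => p.2.down.1) hxy
    rw [← h1] at h2
    have h3 := Nat.count_injective (p := fun j => f x ∈ P j) ⟨x, hidx _ _, rfl⟩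
      ⟨y, hidx _ _, h1.symm⟩ h2
    exact Subtype.ext (hAi _ (hidx x (hwU x)) (h3 ▸ hidx y (hwU y)) h1)
  · rintro ⟨⟨s, hs⟩, ⟨⟨i, hi⟩⟩⟩
    have hs' : #(f ⁻¹' {s}) = m := hs
    obtain ⟨n, ⟨w, hw, rfl⟩, hn⟩ := (hlt s (hnU s hs') i).1 (hs'.symm ▸ hi)
    exact ⟨⟨w, hs⟩, Prod.ext rfl ((hρ ⟨w, hs⟩ n hw _).2 hn)⟩
  · exact fun x y => ⟨fun h => Subtype.ext h, fun h => congrArg Subtype.val h⟩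

theorem borelParametrized_ker {W S : Type u} [MeasurableSpace W] [StandardBorelSpace W]
    [MeasurableSpace S] [StandardBorelSpace S] {f : W → S} (hf : Measurable f)
    (hU : {s | ¬ (f ⁻¹' {s}).Countable}.Countable) : BorelParametrized (Setoid.ker f) := by
  refine borelParametrized_of_fiberParametrized hf ?_
  rintro m ⟨-, hm | rfl⟩
  · exact fiberParametrized_of_le_aleph0 hf hU hm
  · exact fiberParametrized_continuum hf hU

end Parametrization

section Encard

theorem measurable_encard {X : Type*} [MeasurableSpace X] {K : X → Set ℕ}
    (hK : ∀ k, MeasurableSet {x | k ∈ K x}) : Measurable fun x => (K x).encard := by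
  have hle : ∀ k : ℕ, MeasurableSet {x | (k : ℕ∞) ≤ (K x).encard} := by
    intro k
    have : {x | (k : ℕ∞) ≤ (K x).encard} =
        ⋃ t : Finset ℕ, ⋃ (_ : t.card = k), ⋂ i ∈ t, {x | i ∈ K x} := by
      ext x
      simp only [mem_ofPred, mem_iUnion, mem_iInter, exists_prop]
      constructor
      · intro h
        obtain ⟨t, ht, htk⟩ := Set.exists_subset_encard_eq h
        have hfin : t.Finite := Set.finite_of_encard_eq_coe htk
        refine ⟨hfin.toFinset, ?_, fun i hi => ht (by simpa using hi)⟩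
        rw [hfin.encard_eq_coe_toFinset_card] at htk
        exact_mod_cast htk
      · rintro ⟨t, rfl, ht⟩
        rw [← Set.encard_coe_eq_coe_finsetCard]
        exact Set.encard_le_encard fun i hi => ht i hi
    rw [this]
    exact MeasurableSet.iUnion fun t => MeasurableSet.iUnion fun _ =>
      Finset.measurableSet_biInter _ fun i _ => hK i
  refine measurable_to_countable' fun a => ?_
  have : (fun x => (K x).encard) ⁻¹' {a} =
      ⋂ k : ℕ, {x | (k : ℕ∞) ≤ (K x).encard ↔ (k : ℕ∞) ≤ a} := by
    ext x
    simp only [mem_preimage, mem_singleton_iff, mem_iInter, mem_ofPred]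
    refine ⟨fun h k => by rw [h], fun h => le_antisymm ?_ ?_⟩
    · exact ENat.forall_natCast_le_iff_le.1 fun k hk => (h k).1 hk
    · exact ENat.forall_natCast_le_iff_le.1 fun k hk => (h k).2 hk
  rw [this]
  exact MeasurableSet.iInter fun k => measurableSet_setOfPred.2
    ((measurableSet_setOfPred.1 (hle k)).iff measurable_const)

theorem encard_setOf_natCast_lt (a : ℕ∞) : {i : ℕ | (i : ℕ∞) < a}.encard = a := by
  induction a using ENat.recTopCoe with
  | top => simp
  | coe n =>
    have : {i : ℕ | (i : ℕ∞) < n} = (Finset.range n : Set ℕ) := by ext; simp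
    rw [this, Set.encard_coe_eq_coe_finsetCard, Finset.card_range]

end Encard

section LocalFineShape

theorem lfs_mk {X : Type u} {E F : Setoid X} (hEF : E ≤ F) (x : X) (m : {m : ℕ∞ // 1 ≤ m}) :
    (lfs E F (Quotient.mk F x)).1 m =
      {D : Set X | (∃ y, F y x ∧ D = {z | E z y}) ∧ D.encard = m}.encard := by
  change numClasses _ _ = _
  unfold numClasses
  have hinj : Function.Injective
      fun D : Set {z : X // Quotient.mk F z = Quotient.mk F x} => Subtype.val '' D :=
    Set.image_injective.2 Subtype.val_injective
  rw [← hinj.encard_image]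
  congr 1
  have hval : ∀ (y : X) (hy : Quotient.mk F y = Quotient.mk F x),
      Subtype.val '' {z | restrictToClass E F (Quotient.mk F x) z ⟨y, hy⟩} = {z | E z y} := by
    intro y hy
    ext z
    constructor
    · rintro ⟨z, hz, rfl⟩
      exact hz
    · intro hz
      exact ⟨⟨z, (Quotient.sound (hEF hz)).trans hy⟩, hz, rfl⟩
  ext D
  constructor
  · rintro ⟨_, ⟨⟨⟨y, hy⟩, rfl⟩, hc⟩, rfl⟩
    refine ⟨⟨y, Quotient.exact hy, hval y hy⟩, ?_⟩
    rw [← hc]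
    exact Subtype.val_injective.encard_image _
  · rintro ⟨⟨y, hy, rfl⟩, hc⟩
    have hy' : Quotient.mk F y = Quotient.mk F x := Quotient.sound hy
    refine ⟨_, ⟨⟨⟨y, hy'⟩, rfl⟩, ?_⟩, hval y hy'⟩
    rw [← hc, ← hval y hy']
    exact (Subtype.val_injective.encard_image _).symm

theorem lfs_mk_equiv {X Y : Type u} {E F : Setoid X} {E' F' : Setoid Y} (hEF : E ≤ F)
    (hEF' : E' ≤ F') (ψ : X ≃ Y) (hE : ∀ x y, E x y ↔ E' (ψ x) (ψ y))
    (hF : ∀ x y, F x y ↔ F' (ψ x) (ψ y)) (x : X) :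
    lfs E' F' (Quotient.mk F' (ψ x)) = lfs E F (Quotient.mk F x) := by
  apply Subtype.ext
  funext m
  rw [lfs_mk hEF, lfs_mk hEF', ← (Set.image_injective.2 ψ.injective).encard_image]
  congr 1
  have himg : ∀ y, ψ '' {z | E z y} = {z | E' z (ψ y)} := by
    intro y
    ext z
    obtain ⟨z, rfl⟩ := ψ.surjective z
    simp [hE]
  ext D
  constructor
  · rintro ⟨⟨y, hy, rfl⟩, hc⟩
    obtain ⟨y, rfl⟩ := ψ.surjective y
    refine ⟨_, ⟨⟨y, (hF _ _).2 hy, rfl⟩, ?_⟩, himg y⟩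
    rw [← hc, ← himg, ψ.injective.encard_image]
  · rintro ⟨_, ⟨⟨y, hy, rfl⟩, hc⟩, rfl⟩
    refine ⟨⟨ψ y, (hF _ _).1 hy, himg y⟩, ?_⟩
    rw [← hc, ψ.injective.encard_image]

theorem lfs_mk_eq_encard {X : Type u} {E F : Setoid X} (hEF : E ≤ F) {A : ℕ → Set X}
    (hA : ∀ n, ∀ y ∈ A n, ∀ z ∈ A n, F y z → y = z) (hd : Pairwise (Function.onFun Disjoint A))
    (hu : ⋃ n, A n = Set.univ) (x : X) (m : {m : ℕ∞ // 1 ≤ m}) :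
    (lfs E F (Quotient.mk F x)).1 m =
      {n | (∃ y ∈ A n, F y x) ∧ (∀ k < n, ¬ ∃ y ∈ A n, ∃ z ∈ A k, F y x ∧ E y z) ∧
        {k | ∃ y ∈ A n, ∃ z ∈ A k, F y x ∧ E y z}.encard = m}.encard := by
  rw [lfs_mk hEF]
  have hidx : ∀ y, ∃ n, y ∈ A n := fun y => mem_iUnion.1 (hu.symm ▸ mem_univ y)
  choose idx hidx using hidx
  have hidx' : ∀ n y, y ∈ A n → idx y = n := by
    intro n y hy
    by_contra hne
    exact disjoint_left.1 (hd hne) (hidx y) hy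
  have hset : ∀ n, ∀ y ∈ A n, F y x →
      {k | ∃ y ∈ A n, ∃ z ∈ A k, F y x ∧ E y z} = idx '' {z | E z y} := by
    intro n y hy hyx
    ext k
    constructor
    · rintro ⟨y', hy', z, hz, hyx', hyz⟩
      obtain rfl := hA n y hy y' hy' (F.trans hyx (F.symm hyx'))
      exact ⟨z, E.symm hyz, hidx' k z hz⟩
    · rintro ⟨z, hz, rfl⟩
      exact ⟨y, hy, z, hidx z, hyx, E.symm hz⟩
  have hcard : ∀ y, (idx '' {z | E z y}).encard = {z | E z y}.encard := by
    intro y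
    refine InjOn.encard_image ?_
    intro z hz z' hz' hzz
    exact hA _ z (hidx z) z' (hzz ▸ hidx z') (hEF (E.trans hz (E.symm hz')))
  let Θ : Set X → ℕ := fun D => sInf (idx '' D)
  have hΘ : ∀ y, ∃ y', E y' y ∧ idx y' = Θ {z | E z y} := by
    intro y
    obtain ⟨y', hy', h⟩ := Nat.sInf_mem (s := idx '' {z | E z y}) ⟨_, y, E.refl y, rfl⟩
    exact ⟨y', hy', h⟩
  have hcls : ∀ {y y'}, E y' y → {z | E z y} = {z | E z y'} := by
    intro y y' h
    ext z
    exact ⟨fun hz => E.trans hz (E.symm h), fun hz => E.trans hz h⟩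
  have hinj : InjOn Θ {D : Set X | (∃ y, F y x ∧ D = {z | E z y}) ∧ D.encard = m} := by
    rintro _ ⟨⟨y, hy, rfl⟩, -⟩ _ ⟨⟨z, hz, rfl⟩, -⟩ hyz
    obtain ⟨y', hy', h1⟩ := hΘ y
    obtain ⟨z', hz', h2⟩ := hΘ z
    have h3 : idx y' = idx z' := by rw [h1, h2, hyz]
    have h4 : y' = z' := hA _ y' (hidx y') z' (h3 ▸ hidx z')
      (F.trans (F.trans (hEF hy') hy) (F.symm (F.trans (hEF hz') hz)))
    rw [hcls hy', hcls hz', h4]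
  rw [← hinj.encard_image]
  congr 1
  ext n
  constructor
  · rintro ⟨_, ⟨⟨y, hy, rfl⟩, hc⟩, rfl⟩
    obtain ⟨y', hy', h1⟩ := hΘ y
    have hyx : F y' x := F.trans (hEF hy') hy
    rw [← h1]
    refine ⟨⟨y', hidx y', hyx⟩, fun k hk hex => ?_, ?_⟩
    · have hk' : k ∈ idx '' {z | E z y'} := (hset _ y' (hidx y') hyx).subset hex
      rw [← hcls hy'] at hk'
      exact absurd (Nat.sInf_le hk') (not_le.2 (hk.trans_eq h1))
    · rw [hset _ y' (hidx y') hyx, hcard, ← hcls hy', hc]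
  · rintro ⟨⟨y, hy, hyx⟩, hmin, hc⟩
    rw [hset n y hy hyx, hcard] at hc
    refine ⟨_, ⟨⟨y, hyx, rfl⟩, hc⟩, ?_⟩
    refine le_antisymm (Nat.sInf_le ⟨y, E.refl y, hidx' n y hy⟩) ?_
    by_contra! hlt
    obtain ⟨y', hy', h1⟩ := hΘ y
    exact hmin _ hlt ⟨y, hy, y', h1 ▸ hidx y', hyx, E.symm hy'⟩

end LocalFineShape

section Quotient

variable {X : Type u} [MeasurableSpace X] [StandardBorelSpace X] {E F : Setoid X}

theorem exists_transversal_partition (hF : IsSmooth F) (hFc : IsCountable F) :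
    ∃ A : ℕ → Set X, (∀ n, MeasurableSet (A n)) ∧
      (∀ n, ∀ y ∈ A n, ∀ z ∈ A n, F y z → y = z) ∧ Pairwise (Function.onFun Disjoint A) ∧
      ⋃ n, A n = Set.univ := by
  obtain ⟨Z, _, _, g, hg, hgF⟩ := hF
  obtain ⟨A, h1, h2, h3, h4⟩ := exists_disjoint_injOn_cover hg fun s => by
    rcases (g ⁻¹' {s}).eq_empty_or_nonempty with h | ⟨x, rfl⟩
    · rw [h]; exact countable_empty
    · exact (hFc x).mono fun y hy => (hgF x y).2 (Eq.symm hy)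
  exact ⟨A, h1, fun n y hy z hz hyz => h2 n hy hz ((hgF y z).1 hyz), h3, h4⟩

theorem IsSmooth.measurableSet_saturation (hF : IsSmooth F) {A : Set X} (hA : MeasurableSet A)
    (hAF : ∀ y ∈ A, ∀ z ∈ A, F y z → y = z) : MeasurableSet {x | ∃ y ∈ A, F y x} := by
  obtain ⟨Z, _, _, g, hg, hgF⟩ := hF
  have : {x | ∃ y ∈ A, F y x} = g ⁻¹' (g '' A) := by
    ext x
    simp [hgF]
  rw [this]
  exact hg (hA.image_of_measurable_injOn hg fun y hy z hz hyz => hAF y hy z hz ((hgF y z).2 hyz))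

theorem standardBorelSpace_quotient (hF : IsSmooth F) (hFc : IsCountable F) :
    StandardBorelSpace (Quotient F) := by
  obtain ⟨A, hA, hAF, -, hu⟩ := exists_transversal_partition hF hFc
  obtain ⟨Z, _, _, g, hg, hgF⟩ := hF
  let j : Quotient F → Z := Quotient.lift g fun x y h => (hgF x y).1 h
  have hj : MeasurableEmbedding j := by
    refine ⟨?_, measurable_from_quotient.2 hg, fun {s} hs => ?_⟩
    · rintro ⟨x⟩ ⟨y⟩ hxy
      exact Quotient.sound ((hgF x y).2 hxy)
    · have : j '' s = ⋃ n, g '' (A n ∩ (Quotient.mk F) ⁻¹' s) := by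
        ext z
        simp only [mem_iUnion]
        constructor
        · rintro ⟨⟨x⟩, hx, rfl⟩
          obtain ⟨n, hn⟩ := mem_iUnion.1 (hu.symm ▸ mem_univ x)
          exact ⟨n, x, ⟨hn, hx⟩, rfl⟩
        · rintro ⟨n, x, ⟨-, hx⟩, rfl⟩
          exact ⟨_, hx, rfl⟩
      rw [this]
      refine MeasurableSet.iUnion fun n => ((hA n).inter hs).image_of_measurable_injOn hg ?_
      exact fun y hy z hz hyz => hAF n y hy.1 z hz.1 ((hgF y z).2 hyz)
  exact hj.standardBorelSpace

theorem measurable_lfs (hEF : E ≤ F) (hE : IsSmooth E) (hF : IsSmooth F) (hFc : IsCountable F) :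
    Measurable fun C => (lfs E F C).1 := by
  obtain ⟨A, hA, hAF, hd, hu⟩ := exists_transversal_partition hF hFc
  refine measurable_pi_iff.2 fun m => measurable_from_quotient.2 ?_
  have heq : ((fun C => (lfs E F C).1 m) ∘ Quotient.mk'') = fun x =>
      {n | (∃ y ∈ A n, F y x) ∧ (∀ k < n, ¬ ∃ y ∈ A n, ∃ z ∈ A k, F y x ∧ E y z) ∧
        {k | ∃ y ∈ A n, ∃ z ∈ A k, F y x ∧ E y z}.encard = m}.encard :=
    funext fun x => lfs_mk_eq_encard hEF hAF hd hu x m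
  have hR : ∀ n k, MeasurableSet {x | ∃ y ∈ A n, ∃ z ∈ A k, F y x ∧ E y z} := by
    intro n k
    have h1 : MeasurableSet {y | ∃ z ∈ A k, E z y} := hE.measurableSet_saturation (hA k)
      fun y hy z hz hyz => hAF k y hy z hz (hEF hyz)
    convert hF.measurableSet_saturation ((hA n).inter h1)
      fun y hy z hz hyz => hAF n y hy.1 z hz.1 hyz using 1
    ext x
    constructor
    · rintro ⟨y, hy, z, hz, h, h'⟩
      exact ⟨y, ⟨hy, z, hz, E.symm h'⟩, h⟩
    · rintro ⟨y, ⟨hy, z, hz, h'⟩, h⟩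
      exact ⟨y, hy, z, hz, h, E.symm h'⟩
  rw [heq]
  refine measurable_encard fun n => ?_
  have hm : MeasurableSet {x | {k | ∃ y ∈ A n, ∃ z ∈ A k, F y x ∧ E y z}.encard = m} :=
    measurableSet_eq_fun (measurable_encard fun k => hR n k) measurable_const
  simp only [mem_ofPred]
  rw [measurableSet_setOfPred]
  exact (measurableSet_setOfPred.1 (hF.measurableSet_saturation (hA n) (hAF n))).and
    ((Measurable.forall fun k =>
      measurable_const.imp (measurableSet_setOfPred.1 (hR n k)).not).and
        (measurableSet_setOfPred.1 hm))

end Quotient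

section Realization

/-- Over each `w`, put `f w m` classes of size `m` for every `m`. -/
def realizationSet {W : Type u} (f : W → LocalFineShape) :
    Set (W × {m : ℕ∞ // 1 ≤ m} × ℕ × ℕ) :=
  {p | (p.2.2.1 : ℕ∞) < (f p.1).1 p.2.1 ∧ (p.2.2.2 : ℕ∞) < p.2.1}

/-- The finer relation of the realization. -/
def realizationFine {W : Type u} (f : W → LocalFineShape) : Setoid (realizationSet f) :=
  Setoid.ker fun y => (y.1.1, y.1.2.1, y.1.2.2.1)

/-- The coarser relation of the realization. -/
def realizationCoarse {W : Type u} (f : W → LocalFineShape) : Setoid (realizationSet f) :=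
  Setoid.ker fun y => y.1.1

variable {W : Type u} (f : W → LocalFineShape)

theorem realizationFine_iff (x y : realizationSet f) : realizationFine f x y ↔
    (x.1.1, x.1.2.1, x.1.2.2.1) = (y.1.1, y.1.2.1, y.1.2.2.1) := Iff.rfl

theorem realizationCoarse_iff (x y : realizationSet f) :
    realizationCoarse f x y ↔ x.1.1 = y.1.1 := Iff.rfl

theorem realizationFine_le : realizationFine f ≤ realizationCoarse f :=
  fun x y h => (realizationCoarse_iff f x y).2
    (congrArg (fun p => p.1) ((realizationFine_iff f x y).1 h))

theorem lfs_realization (y : realizationSet f) :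
    lfs (realizationFine f) (realizationCoarse f) (Quotient.mk _ y) = f y.1.1 := by
  apply Subtype.ext
  funext m
  rw [lfs_mk (realizationFine_le f), ← encard_setOf_natCast_lt ((f y.1.1).1 m)]
  have hm0 : ((0 : ℕ) : ℕ∞) < m.1 := by
    rw [Nat.cast_zero]; exact lt_of_lt_of_le zero_lt_one m.2
  let D : ℕ → Set (realizationSet f) := fun i => {z | (z.1.1, z.1.2.1, z.1.2.2.1) = (y.1.1, m, i)}
  have hD : ∀ z : realizationSet f, {z' | realizationFine f z' z}.encard = z.1.2.1 := by
    intro z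
    let j : realizationSet f → ℕ := fun z => z.1.2.2.2
    have hj : InjOn j {z' | realizationFine f z' z} := by
      rintro ⟨⟨a, b, c, d⟩, h⟩ hz ⟨⟨a', b', c', d'⟩, h'⟩ hz' hjj
      have := Eq.trans hz (Eq.symm hz')
      simp only [Prod.mk.injEq] at this
      obtain ⟨rfl, rfl, rfl⟩ := this
      obtain rfl : d = d' := hjj
      rfl
    rw [← hj.encard_image, ← encard_setOf_natCast_lt z.1.2.1]
    congr 1
    ext d
    constructor
    · rintro ⟨z', hz', rfl⟩
      have h2 := z'.2.2
      have h3 : z'.1.2.1 = z.1.2.1 := congrArg (fun p => p.2.1) hz'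
      rw [h3] at h2
      exact h2
    · intro hd
      exact ⟨⟨(z.1.1, z.1.2.1, z.1.2.2.1, d), z.2.1, hd⟩, rfl, rfl⟩
  have hinj : InjOn D {i : ℕ | (i : ℕ∞) < (f y.1.1).1 m} := by
    intro i hi i' _ hii
    have h1 : (⟨(y.1.1, m, i, 0), hi, hm0⟩ : realizationSet f) ∈ D i := rfl
    rw [hii] at h1
    exact congrArg (fun p => p.2.2) h1
  rw [← hinj.encard_image]
  congr 1
  ext C
  constructor
  · rintro ⟨⟨z, hz, rfl⟩, hc⟩
    rw [hD] at hc
    have hz : z.1.1 = y.1.1 := hz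
    have hc : z.1.2.1 = m := Subtype.ext hc
    refine ⟨z.1.2.2.1, ?_, ?_⟩
    · have := z.2.1
      rw [hz, hc] at this
      exact this
    · simp only [D, ← hz, ← hc]
      rfl
  · rintro ⟨i, hi, rfl⟩
    have h : D i = {z | realizationFine f z ⟨(y.1.1, m, i, 0), hi, hm0⟩} := rfl
    exact ⟨⟨⟨(y.1.1, m, i, 0), hi, hm0⟩, rfl, h⟩, by rw [h, hD]⟩

theorem isCountable_realizationCoarse : IsCountable (realizationCoarse f) := by
  intro x
  have hinj : InjOn (fun y : realizationSet f => y.1.2) {y | realizationCoarse f x y} := by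
    intro y hy y' hy' h
    exact Subtype.ext (Prod.ext (Eq.trans (Eq.symm hy) hy') h)
  exact countable_of_injective_of_countable_image hinj (to_countable _)

theorem isCountable_realizationFine : IsCountable (realizationFine f) := fun x =>
  (isCountable_realizationCoarse f x).mono fun _ h => realizationFine_le f h

variable [MeasurableSpace W]

theorem isSmooth_realizationCoarse [StandardBorelSpace W] : IsSmooth (realizationCoarse f) :=
  ⟨W, inferInstance, inferInstance, fun y => y.1.1,
    measurable_fst.comp measurable_subtype_coe, fun _ _ => Iff.rfl⟩

theorem isSmooth_realizationFine [StandardBorelSpace W] : IsSmooth (realizationFine f) :=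
  ⟨W × {m : ℕ∞ // 1 ≤ m} × ℕ, inferInstance, inferInstance,
    fun y => (y.1.1, y.1.2.1, y.1.2.2.1), by fun_prop, fun _ _ => Iff.rfl⟩

variable {f}

theorem measurableSet_realizationSet (hf : Measurable fun w => (f w).1) :
    MeasurableSet (realizationSet f) := by
  have hlt : ∀ {α : Type u} [MeasurableSpace α] {a b : α → ℕ∞}, Measurable a → Measurable b →
      MeasurableSet {x | a x < b x} := fun ha hb =>
    (ha.prodMk hb) (MeasurableSet.of_discrete (s := {p : ℕ∞ × ℕ∞ | p.1 < p.2}))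
  refine (hlt (Measurable.of_discrete.comp (by fun_prop)) ?_).inter
    (hlt (Measurable.of_discrete.comp (by fun_prop)) (by fun_prop))
  have h1 : Measurable fun p : ({m : ℕ∞ // 1 ≤ m} → ℕ∞) × {m : ℕ∞ // 1 ≤ m} => p.1 p.2 :=
    measurable_from_prod_countable_left fun m => measurable_pi_apply m
  exact h1.comp (((hf.comp measurable_fst)).prodMk (by fun_prop))

theorem exists_section_realization (hf : Measurable fun w => (f w).1) :
    ∃ σ : W → realizationSet f, Measurable σ ∧ ∀ w, (σ w).1.1 = w := by
  classical
  have : Nonempty {m : ℕ∞ // 1 ≤ m} := ⟨⟨1, le_rfl⟩⟩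
  obtain ⟨e, he⟩ := exists_surjective_nat {m : ℕ∞ // 1 ≤ m}
  have hne : ∀ w, ∃ n, (f w).1 (e n) ≠ 0 := by
    intro w
    obtain ⟨m, hm⟩ := Function.ne_iff.1 (f w).2
    obtain ⟨n, rfl⟩ := he m
    exact ⟨n, hm⟩
  have hmeas : Measurable fun w => Nat.find (hne w) := measurable_find hne fun n =>
    (measurableSet_eq_fun ((measurable_pi_apply (e n)).comp hf) measurable_const).compl
  refine ⟨fun w => ⟨(w, e (Nat.find (hne w)), 0, 0), ?_, ?_⟩, Measurable.subtype_mk ?_,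
    fun _ => rfl⟩
  · rw [Nat.cast_zero]; exact pos_iff_ne_zero.2 (Nat.find_spec (hne w))
  · rw [Nat.cast_zero]; exact lt_of_lt_of_le zero_lt_one (e _).2
  · exact measurable_id.prodMk ((Measurable.of_discrete.comp hmeas).prodMk measurable_const)

theorem gfs_realization (hf : Measurable fun w => (f w).1) (α : LocalFineShape) :
    gfs (realizationFine f) (realizationCoarse f) α = #{w // f w = α} := by
  obtain ⟨σ, -, hσ⟩ := exists_section_realization hf
  let p : Quotient (realizationCoarse f) → W := Quotient.lift (fun y => y.1.1) fun _ _ h => h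
  have hp : Function.Bijective p := by
    refine ⟨?_, fun w => ⟨Quotient.mk _ (σ w), hσ w⟩⟩
    rintro ⟨x⟩ ⟨y⟩ h
    exact Quotient.sound h
  refine Cardinal.mk_congr ((Equiv.ofBijective p hp).subtypeEquiv ?_)
  rintro ⟨y⟩
  change lfs _ _ (Quotient.mk _ y) = α ↔ f y.1.1 = α
  rw [lfs_realization]

end Realization

section Modification

/-- For an uncountable standard Borel space `B` there is a Borel surjection onto `B`
that admits, or does not admit, a Borel section, as prescribed. -/
theorem exists_surjective_section_iff {B : Type u} [MeasurableSpace B] [StandardBorelSpace B]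
    (hB : ¬ Countable B) (p : Prop) : ∃ (R : Type u) (_ : MeasurableSpace R)
      (_ : StandardBorelSpace R) (r : R → B), Measurable r ∧ Function.Surjective r ∧
        ((∃ k : B → R, Measurable k ∧ ∀ b, r (k b) = b) ↔ p) := by
  by_cases hp : p
  · exact ⟨B, inferInstance, inferInstance, id, measurable_id, Function.surjective_id,
      iff_of_true ⟨id, measurable_id, fun _ => rfl⟩ hp⟩
  · obtain ⟨Q, _, _, q, hq, hqs, hqn⟩ := exists_surjective_not_exists_section
    let e := PolishSpace.measurableEquivNatBoolOfNotCountable hB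
    refine ⟨ULift.{u} Q, inferInstance, inferInstance, fun x => e.symm (q x.down),
      e.symm.measurable.comp (hq.comp measurable_down),
      e.symm.surjective.comp (hqs.comp ULift.down_surjective), iff_of_false ?_ hp⟩
    rintro ⟨k, hk, hkb⟩
    refine hqn ⟨fun z => (k (e.symm z)).down, measurable_down.comp (hk.comp e.symm.measurable),
      fun z => ?_⟩
    exact e.symm.injective (hkb (e.symm z))

variable {W S R : Type u} [MeasurableSpace W] [MeasurableSpace S] [MeasurableSpace R]

/-- Replace the part of `f` over `B` by `r`, with fibers multiplied by the Cantor space. -/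
def modifyOver (f : W → S) (B : Set S) (r : R → B) : {w // f w ∉ B} ⊕ (R × (ℕ → Bool)) → S :=
  Sum.elim (fun w => f w) fun q => r q.1

theorem measurable_modifyOver {f : W → S} (hf : Measurable f) {B : Set S} {r : R → B}
    (hr : Measurable r) : Measurable (modifyOver f B r) :=
  measurable_fun_sum (hf.comp measurable_subtype_coe)
    (measurable_subtype_coe.comp (hr.comp measurable_fst))

theorem mk_fiber_modifyOver [StandardBorelSpace W] [StandardBorelSpace R] [StandardBorelSpace S]
    {f : W → S} (hf : Measurable f) {B : Set S} (hBm : MeasurableSet B)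
    (hB : B ⊆ {s | ¬ (f ⁻¹' {s}).Countable}) {r : R → B} (hr : Measurable r)
    (hrs : Function.Surjective r) (s : S) : #(modifyOver f B r ⁻¹' {s}) = #(f ⁻¹' {s}) := by
  have hst : StandardBorelSpace {w // f w ∉ B} := (hf hBm.compl).standardBorel
  by_cases hs : s ∈ B
  · rw [mk_eq_continuum_of_not_countable (hf (measurableSet_singleton s)) (hB hs)]
    refine mk_eq_continuum_of_not_countable
      (measurable_modifyOver hf hr (measurableSet_singleton s)) fun hc => ?_
    obtain ⟨a, ha⟩ := hrs ⟨s, hs⟩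
    let j : (ℕ → Bool) → {w // f w ∉ B} ⊕ (R × (ℕ → Bool)) := fun x => Sum.inr (a, x)
    have hj : Function.Injective j := fun x y h => congrArg Prod.snd (Sum.inr_injective h)
    have hsub : range j ⊆ modifyOver f B r ⁻¹' {s} := by
      rintro _ ⟨x, rfl⟩
      exact congrArg Subtype.val ha
    have := (hc.mono hsub).to_subtype
    exact not_countable_nat_bool (rangeFactorization_injective.2 hj).countable
  · symm
    refine Cardinal.mk_congr (Equiv.ofBijective
      (fun w => ⟨Sum.inl ⟨w.1, fun h => hs (w.2 ▸ h)⟩, w.2⟩) ⟨fun x y h => ?_, ?_⟩)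
    · have h1 := Sum.inl_injective (congrArg Subtype.val h)
      exact Subtype.ext (congrArg Subtype.val h1 :)
    · rintro ⟨w | q, hw⟩
      · exact ⟨⟨w.1, hw⟩, rfl⟩
      · have hq : (r q.1 : S) = s := hw
        exact absurd (hq ▸ (r q.1).2) hs

theorem exists_section_modifyOver_iff {f : W → S} {B : Set S} (hne : B.Nonempty) {r : R → B}
    (hrs : Function.Surjective r) :
    (∃ k : B → {w // f w ∉ B} ⊕ (R × (ℕ → Bool)),
      Measurable k ∧ ∀ b, modifyOver f B r (k b) = b) ↔
    ∃ k : B → R, Measurable k ∧ ∀ b, r (k b) = b := by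
  constructor
  · rintro ⟨k, hk, hkb⟩
    obtain ⟨a, -⟩ := hrs ⟨_, hne.some_mem⟩
    refine ⟨fun b => Sum.elim (fun _ => a) Prod.fst (k b),
      (measurable_fun_sum measurable_const measurable_fst).comp hk, fun b => ?_⟩
    have hb := hkb b
    rcases h : k b with w | q
    · rw [h] at hb
      have hw : f w.1 = b := hb
      exact absurd (hw ▸ b.2) w.2
    · rw [h] at hb
      simp only [h, Sum.elim_inr]
      exact Subtype.ext hb
  · rintro ⟨k, hk, hkb⟩
    refine ⟨fun b => Sum.inr (k b, fun _ => false),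
      measurable_inr.comp (hk.prodMk measurable_const), fun b => ?_⟩
    exact congrArg Subtype.val (hkb b)

end Modification

/-- Having a Borel choice of points over `B` with prescribed local fine shape
is invariant under simultaneous Borel isomorphism. -/
theorem SimBorelIso.exists_section_iff {X Y T : Type u} [MeasurableSpace X] [MeasurableSpace Y]
    [MeasurableSpace T] {E F : Setoid X} {E' F' : Setoid Y} (hEF : E ≤ F) (hEF' : E' ≤ F')
    (h : SimBorelIso E F E' F') (v : T → {m : ℕ∞ // 1 ≤ m} → ℕ∞) :
    (∃ k : T → X, Measurable k ∧ ∀ b, (lfs E F (Quotient.mk F (k b))).1 = v b) ↔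
      ∃ k : T → Y, Measurable k ∧ ∀ b, (lfs E' F' (Quotient.mk F' (k b))).1 = v b := by
  obtain ⟨ψ, hE, hF⟩ := h
  have hψ := lfs_mk_equiv hEF hEF' ψ.toEquiv hE hF
  constructor
  · rintro ⟨k, hk, hkb⟩
    refine ⟨fun b => ψ (k b), ψ.measurable.comp hk, fun b => ?_⟩
    rw [← hkb b]
    exact congrArg Subtype.val (hψ (k b))
  · rintro ⟨k, hk, hkb⟩
    refine ⟨fun b => ψ.symm (k b), ψ.symm.measurable.comp hk, fun b => ?_⟩
    rw [← hψ, ← hkb b]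
    simp

end SmoothPairs

open SmoothPairs

theorem theorem6p9 {X : Type u} [MeasurableSpace X] [StandardBorelSpace X] (E F : Setoid X)
    (hEF : E ≤ F)
    (hE : SmoothPairs.IsSmooth E) (hEc : SmoothPairs.IsCountable E)
    (hF : SmoothPairs.IsSmooth F) (hFc : SmoothPairs.IsCountable F)
    (hBP : ¬ SmoothPairs.BorelParametrized (SmoothPairs.lfsRel E F)) :
    ∃ (Y : Type u) (_ : MeasurableSpace Y) (_ : StandardBorelSpace Y) (E' F' : Setoid Y),
      E' ≤ F' ∧
      SmoothPairs.IsSmooth E' ∧ SmoothPairs.IsCountable E' ∧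
      SmoothPairs.IsSmooth F' ∧ SmoothPairs.IsCountable F' ∧
      SmoothPairs.gfs E F = SmoothPairs.gfs E' F' ∧
      ¬ SmoothPairs.SimBorelIso E F E' F' := by
  have hW : StandardBorelSpace (Quotient F) := standardBorelSpace_quotient hF hFc
  let f : Quotient F → ULift.{u} ({m : ℕ∞ // 1 ≤ m} → ℕ∞) := fun C => ULift.up (lfs E F C).1
  have hf : Measurable f := measurable_up.comp (measurable_lfs hEF hE hF hFc)
  have hker : lfsRel E F = Setoid.ker f := by
    ext C C'
    change lfs E F C = lfs E F C' ↔ f C = f C'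
    exact ⟨fun h => by simp only [f, h], fun h => Subtype.ext (congrArg ULift.down h)⟩
  have hU : ¬ {s | ¬ (f ⁻¹' {s}).Countable}.Countable := fun hU =>
    hBP (hker ▸ borelParametrized_ker hf hU)
  obtain ⟨B, hBU, hBm, hBc⟩ := exists_measurableSet_uncountable_fibers hf hU
  have hBne : B.Nonempty := by
    by_contra h
    exact hBc (not_nonempty_iff_eq_empty.1 h ▸ countable_empty)
  have hBst := hBm.standardBorel
  obtain ⟨R, _, _, r, hr, hrs, hrk⟩ := exists_surjective_section_iff (B := B) hBc
    (¬ ∃ k : B → X, Measurable k ∧ ∀ b, (lfs E F (Quotient.mk F (k b))).1 = b.1.down)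
  have hst : StandardBorelSpace {C // f C ∉ B} := (hf hBm.compl).standardBorel
  let g := modifyOver f B r
  have hg : Measurable g := measurable_modifyOver hf hr
  have hmk := mk_fiber_modifyOver hf hBm hBU hr hrs
  have hg0 : ∀ w, (g w).down ≠ 0 := by
    intro w
    have h1 : #(g ⁻¹' {g w}) ≠ 0 := Cardinal.mk_ne_zero_iff.2 ⟨⟨w, rfl⟩⟩
    rw [hmk] at h1
    obtain ⟨C, hC⟩ := Cardinal.mk_ne_zero_iff.1 h1
    rw [← hC]
    exact (lfs E F C).2
  let g' : {C // f C ∉ B} ⊕ (R × (ℕ → Bool)) → LocalFineShape := fun w => ⟨(g w).down, hg0 w⟩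
  have hg' : Measurable fun w => (g' w).1 := measurable_down.comp hg
  have hst' := (measurableSet_realizationSet hg').standardBorel
  refine ⟨realizationSet g', inferInstance, hst', realizationFine g', realizationCoarse g',
    realizationFine_le g', isSmooth_realizationFine g', isCountable_realizationFine g',
    isSmooth_realizationCoarse g', isCountable_realizationCoarse g', ?_, fun hiso => ?_⟩
  · funext α
    rw [gfs_realization hg']
    have h1 : ∀ C, lfs E F C = α ↔ C ∈ f ⁻¹' {ULift.up α.1} := fun C =>
      ⟨fun h => by simp [f, h], fun h => Subtype.ext (congrArg ULift.down h)⟩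
    have h2 : ∀ w, g' w = α ↔ w ∈ g ⁻¹' {ULift.up α.1} := fun w =>
      ⟨fun h => ULift.ext _ _ (congrArg Subtype.val h),
        fun h => Subtype.ext (congrArg ULift.down h)⟩
    calc gfs E F α = #(f ⁻¹' {ULift.up α.1}) := Cardinal.mk_congr (Equiv.subtypeEquivRight h1)
      _ = #(g ⁻¹' {ULift.up α.1}) := (hmk _).symm
      _ = _ := (Cardinal.mk_congr (Equiv.subtypeEquivRight h2)).symm
  · have h1 := hiso.exists_section_iff hEF (realizationFine_le g') fun b : B => b.1.down
    have h2 : (∃ k : B → realizationSet g', Measurable k ∧ ∀ b, (lfs (realizationFine g')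
        (realizationCoarse g') (Quotient.mk _ (k b))).1 = b.1.down) ↔
        ∃ k : B → R, Measurable k ∧ ∀ b, r (k b) = b := by
      rw [← exists_section_modifyOver_iff (f := f) hBne hrs]
      constructor
      · rintro ⟨k, hk, hkb⟩
        refine ⟨fun b => (k b).1.1, measurable_fst.comp (measurable_subtype_coe.comp hk),
          fun b => ?_⟩
        have h3 := hkb b
        rw [lfs_realization] at h3
        exact ULift.ext _ _ h3
      · rintro ⟨k, hk, hkb⟩
        obtain ⟨σ, hσ, hσw⟩ := exists_section_realization hg'
        refine ⟨fun b => σ (k b), hσ.comp hk, fun b => ?_⟩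
        rw [lfs_realization, hσw]
        exact congrArg ULift.down (hkb b)
    rw [h2, hrk] at h1
    exact iff_not_self h1
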